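/- Let $k$ be any field and $n \ge 1$. Take the $10(n+1)$ variables $S^{(m)}, F^{(m)}, C_i^{(m)}, B_i^{(m)}$ ($0 \le m \le n$, $1 \le i \le 4$) and one more variable $u$. Let $I_n^H$ be the ideal, in the polynomial ring over $k$ in all these variables, generated by the homogenizations with respect to $u$ of the $10n+4$ Mayr–Meyer binomials $$S^{(m)} - S^{(m-1)}C_1^{(m-1)},\quad F^{(m)} - S^{(m-1)}C_4^{(m-1)},\quad C_i^{(m)}F^{(m-1)}B_2^{(m-1)} - C_i^{(m)}B_i^{(m)}F^{(m-1)}B_3^{(m-1)} \qquad (1\le m\le n,\ 1\le i\le 4),$$ $$F^{(m)}C_1^{(m)}B_1^{(m)} - S^{(m)}C_2^{(m)},\quad F^{(m)}C_2^{(m)} - F^{(m)}C_3^{(m)},\quad S^{(m)}C_3^{(m)}B_1^{(m)} - S^{(m)}C_2^{(m)}B_4^{(m)},\quad S^{(m)}C_3^{(m)} - F^{(m)}C_4^{(m)}B_4^{(m)} \qquad (0\le m\le n-1),$$ $$C_i^{(0)}S^{(0)} - C_i^{(0)}F^{(0)}(B_i^{(0)})^2 \qquad (1\le i\le 4),$$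 and let $J = J_n^H = (S^{(n)}, F^{(n)}) + I_n^H$. Let $d(J)$ be the maximal degree of an element of a minimal set of homogeneous generators of $J$. Let $m(J)$ be the regularity of $J$, i.e. the least $m$ such that, in a minimal graded free resolution $\cdots \to \bigoplus_\alpha k[X]\,e_{\alpha,1} \to \bigoplus_\alpha k[X]\,e_{\alpha,0} \to J \to 0$, one has $\deg e_{\alpha,i} \le m+i$ for all $\alpha$ and $i$. Then $$d(J) = 4, \qquad m(J) \ge 2^{2^n}+1.$$ Moreover $J$ has a minimal first syzygy of degree at least $2^{2^n}+2$: in every minimal graded free resolution as above, $\deg e_{\alpha,1} \ge 2^{2^n}+2$ for some $\alpha$. -/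

import Mathlib

namespace MayrMeyer

open MvPolynomial

/-- The variables `S^(m)`, `F^(m)`, `C_i^(m)`, `B_i^(m)` on the levels `m = 0, …, n`.
The index `i = 1, 2, 3, 4` is written `0, 1, 2, 3 : Fin 4`. -/
inductive Var (n : ℕ) : Type
  | S (m : Fin (n + 1)) : Var n
  | F (m : Fin (n + 1)) : Var n
  | C (m : Fin (n + 1)) (i : Fin 4) : Var n
  | B (m : Fin (n + 1)) (i : Fin 4) : Var n

section Generators

variable (k : Type*) [Field k] {n : ℕ}

/-- The variable `S^(m)` as a polynomial. -/
noncomputable def vS (m : Fin (n + 1)) : MvPolynomial (Var n) k := X (Var.S m)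

/-- The variable `F^(m)` as a polynomial. -/
noncomputable def vF (m : Fin (n + 1)) : MvPolynomial (Var n) k := X (Var.F m)

/-- The variable `C_i^(m)` as a polynomial. -/
noncomputable def vC (m : Fin (n + 1)) (i : Fin 4) : MvPolynomial (Var n) k := X (Var.C m i)

/-- The variable `B_i^(m)` as a polynomial. -/
noncomputable def vB (m : Fin (n + 1)) (i : Fin 4) : MvPolynomial (Var n) k := X (Var.B m i)

/-- Generators that tie a level `h` to the level `l` just below it. -/
def linkGenerators (l h : Fin (n + 1)) : Set (MvPolynomial (Var n) k) :=
  {vS k h - vS k l * vC k l 0,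
   vF k h - vS k l * vC k l 3} ∪
  Set.range (fun i : Fin 4 =>
    vC k h i * vF k l * vB k l 1 - vC k h i * vB k h i * vF k l * vB k l 2)

/-- Generators that live on a single level `l` (used on every level but the top one). -/
def loopGenerators (l : Fin (n + 1)) : Set (MvPolynomial (Var n) k) :=
  {vF k l * vC k l 0 * vB k l 0 - vS k l * vC k l 1,
   vF k l * vC k l 1 - vF k l * vC k l 2,
   vS k l * vC k l 2 * vB k l 0 - vS k l * vC k l 1 * vB k l 3,
   vS k l * vC k l 2 - vF k l * vC k l 3 * vB k l 3}

/-- Generators on the bottom level. -/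
def baseGenerators : Set (MvPolynomial (Var n) k) :=
  Set.range (fun i : Fin 4 =>
    vC k 0 i * vS k 0 - vC k 0 i * vF k 0 * vB k 0 i ^ 2)

variable (n)

/-- The `10 n + 4` generators of the (affine) Mayr–Meyer ideal with levels `0, …, n`. -/
def generators : Set (MvPolynomial (Var n) k) :=
  (⋃ m : Fin n, linkGenerators k m.castSucc m.succ) ∪
  (⋃ m : Fin n, loopGenerators k m.castSucc) ∪
  baseGenerators k

end Generators

/-- Homogenization of a polynomial with respect to a new variable `u = X none`. -/
noncomputable def homogenize {σ k : Type*} [Field k] (f : MvPolynomial σ k) :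
    MvPolynomial (Option σ) k :=
  ∑ a ∈ f.support,
    rename some (monomial a (f.coeff a)) * X none ^ (f.totalDegree - a.degree)

/-- The ideal `I_n^H`, generated by the homogenizations of the Mayr–Meyer generators. -/
noncomputable def idealI (k : Type*) [Field k] (n : ℕ) :
    Ideal (MvPolynomial (Option (Var n)) k) :=
  Ideal.span (homogenize '' generators k n)

/-- The ideal `J_n^H = (S^(n), F^(n), I_n^H)`. -/
noncomputable def idealJ (k : Type*) [Field k] (n : ℕ) :
    Ideal (MvPolynomial (Option (Var n)) k) :=
  Ideal.span {X (some (Var.S (Fin.last n))), X (some (Var.F (Fin.last n)))} ⊔ idealI k n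

section Regularity

variable {σ k : Type*} [Field k]

/-- `s` is a minimal set of homogeneous generators of the ideal `I`. -/
def IsMinimalGeneratingSet (I : Ideal (MvPolynomial σ k)) (s : Set (MvPolynomial σ k)) : Prop :=
  Minimal (fun t : Set (MvPolynomial σ k) =>
    (∀ f ∈ t, ∃ e : ℕ, f.IsHomogeneous e) ∧ Ideal.span t = I) s

/-- `d(I)`: the maximal degree of an element of a minimal set of homogeneous generators of `I`
(all these sets have the same degrees). -/
noncomputable def generatingDegree (I : Ideal (MvPolynomial σ k)) : ℕ∞ :=
  ⨆ (s : Set (MvPolynomial σ k)) (_ : IsMinimalGeneratingSet I s) (f ∈ s), (f.totalDegree : ℕ∞)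

/-- A minimal graded resolution
`… → F_1 → F_0 → I → 0` of a homogeneous ideal `I` of a polynomial ring by graded free modules of
finite rank; `F_i` has the basis `e_{α,i} = Pi.single α 1`, and `deg i α` is the degree of
`e_{α,i}`. -/
structure MinimalResolution (I : Ideal (MvPolynomial σ k)) where
  /-- the rank of `F_i` -/
  rank : ℕ → ℕ
  /-- the degrees of the basis vectors of `F_i` -/
  deg : (i : ℕ) → Fin (rank i) → ℕ
  /-- the map `F_0 → k[X]` with image `I` -/
  aug : (Fin (rank 0) → MvPolynomial σ k) →ₗ[MvPolynomial σ k] MvPolynomial σ k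
  /-- the maps `F_{i+1} → F_i` -/
  d : (i : ℕ) → (Fin (rank (i + 1)) → MvPolynomial σ k) →ₗ[MvPolynomial σ k]
    (Fin (rank i) → MvPolynomial σ k)
  range_aug : LinearMap.range aug = I
  exact_zero : LinearMap.range (d 0) = LinearMap.ker aug
  exact_succ : ∀ i, LinearMap.range (d (i + 1)) = LinearMap.ker (d i)
  /-- the map `F_0 → k[X]` preserves degrees -/
  aug_homogeneous : ∀ α, (aug (Pi.single α 1)).IsHomogeneous (deg 0 α)
  /-- the maps `F_{i+1} → F_i` preserve degrees -/
  d_homogeneous : ∀ i α β, d i (Pi.single α 1) β = 0 ∨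
    ∃ c : ℕ, deg i β + c = deg (i + 1) α ∧ (d i (Pi.single α 1) β).IsHomogeneous c
  /-- minimality: the matrices of `F_{i+1} → F_i` have their entries in the ideal generated by
  the variables -/
  d_minimal : ∀ i α β, constantCoeff (d i (Pi.single α 1) β) = 0

/-- `I` is `m`-regular: `deg e_{α,i} ≤ m + i` for all `α`, `i` in a minimal graded free resolution
of `I` (the degrees do not depend on the resolution). -/
def IsRegular (I : Ideal (MvPolynomial σ k)) (m : ℕ∞) : Prop :=
  ∀ (P : MinimalResolution I) (i : ℕ) (α : Fin (P.rank i)), (P.deg i α : ℕ∞) ≤ m + i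

/-- `m(I)`: the Castelnuovo–Mumford regularity of `I`, the least `m` such that `I` is
`m`-regular. -/
noncomputable def regularity (I : Ideal (MvPolynomial σ k)) : ℕ∞ :=
  sInf {m : ℕ∞ | IsRegular I m}

end Regularity

end MayrMeyer

/-! Write e_m = 2^(2^m), S and F for the top variables, and C_0, ..., C_3 for the modes, indexed as
in the code.

The Mayr–Meyer binomials imply C_0 S = C_0 F B_0^(e_n) (`ladder_relation`): a run of level m + 1
consists of e_m rounds of e_m transfers each, so the exponent is squared from level to level.
Homogenized, this becomes pS + qF ∈ I with p = C_0 u^s (`exists_relation`), a syzygy modulo I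
between the generators S and F of J.

No cheaper relation involves C_0 in this way. If aS + bF ∈ I and deg b ≤ e_n, then a at u = 1 has
neither a constant term nor a term in C_0 (`coeff_eq_zero_of_mem_idealI`). Such a form an ideal N
(`lowTermIdeal`). Assign to every vector of F_0 an S-coefficient Φ. If all basis syzygies had degree
at most e_n + 1, their F-coefficients would have degree at most e_n, so Φ would send every syzygy
into N. The ladder relation yields a syzygy on which Φ is p modulo N, and p ∉ N
(`exists_large_syzygy`).

The bound on cheap relations comes from linear functionals. A sum of coefficients over the monomials
with some property kills I at u = 1 as soon as no generating binomial changes the property. The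
property reads a monomial as a configuration of a machine: C_j is the mode of a level, the exponents
of the B_j are its counters, and S and F mark the two ends of a run. `Run` fixes the mode j and the
values q that the counters take once the current run has reached F; the progress v of the lower
levels accounts for the part of B_j still to be added. `Progress` computes from j and q the progress
seen one level higher. A transfer binomial raises v by one and B_j by one, so q stays the same.

The equality d(J) = 4 follows from a point that kills all generators of degree at most 3 but not J.
The regularity bound also needs the existence of a minimal resolution, since regularity is defined
by quantifying over all of them. -/

namespace MayrMeyer

open MvPolynomial

/-! ### Graded free modules and existence of minimal graded resolutions. -/

section GradedModules

variable {σ k : Type*} [Field k]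

/-- The homogeneous component of degree `n - c`, or `0` if `n < c`. -/
noncomputable def shiftedComponent (c n : ℕ) : MvPolynomial σ k →ₗ[k] MvPolynomial σ k :=
  if c ≤ n then homogeneousComponent (n - c) else 0

theorem shiftedComponent_isHomogeneous (c n : ℕ) (p : MvPolynomial σ k) :
    shiftedComponent c n p = 0 ∨
      ∃ e, c + e = n ∧ (shiftedComponent c n p).IsHomogeneous e := by
  unfold shiftedComponent
  split_ifs with h
  · exact Or.inr ⟨n - c, by omega, homogeneousComponent_isHomogeneous _ _⟩
  · exact Or.inl rfl

theorem homogeneousComponent_mul_of_isHomogeneous {q : MvPolynomial σ k} {c : ℕ}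
    (hq : q.IsHomogeneous c) (n : ℕ) (p : MvPolynomial σ k) :
    homogeneousComponent n (p * q) = shiftedComponent c n p * q := by
  conv_lhs => rw [← sum_homogeneousComponent p, Finset.sum_mul, map_sum]
  have h : ∀ i, homogeneousComponent n (homogeneousComponent i p * q) =
      if n = i + c then homogeneousComponent i p * q else 0 := fun i =>
    homogeneousComponent_of_mem ((homogeneousComponent_isHomogeneous i p).mul hq)
  simp only [h]
  unfold shiftedComponent
  split_ifs with hc
  · obtain ⟨m, rfl⟩ := Nat.exists_eq_add_of_le hc
    have : ∀ i, (c + m = i + c) ↔ (m = i) := fun i => by omega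
    simp only [this, Finset.sum_ite_eq, Nat.add_sub_cancel_left]
    split_ifs with hm
    · rfl
    · rw [homogeneousComponent_eq_zero _ _ (by simpa using hm), zero_mul]
  · rw [LinearMap.zero_apply, zero_mul]
    exact Finset.sum_eq_zero fun i _ => if_neg (by omega)

theorem shiftedComponent_mul_of_isHomogeneous {q : MvPolynomial σ k} {c : ℕ}
    (hq : q.IsHomogeneous c) (a n : ℕ) (p : MvPolynomial σ k) :
    shiftedComponent a n (p * q) = shiftedComponent (a + c) n p * q := by
  have h := homogeneousComponent_mul_of_isHomogeneous hq (n - a) p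
  unfold shiftedComponent at h ⊢
  by_cases h1 : a ≤ n
  · rw [if_pos h1, h]
    by_cases h2 : a + c ≤ n
    · rw [if_pos h2, if_pos (by omega), Nat.sub_sub]
    · rw [if_neg h2, if_neg (by omega)]
  · rw [if_neg h1, if_neg (by omega)]
    simp

/-- In the degree D part of a combination of homogeneous generators, a generator of degree above D
contributes nothing. -/
theorem mem_span_of_totalDegree_le {s : Set (MvPolynomial σ k)}
    (hs : ∀ g ∈ s, ∃ e, g.IsHomogeneous e) {f : MvPolynomial σ k} {D : ℕ}
    (hf : f.IsHomogeneous D) (h : f ∈ Ideal.span s) :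
    f ∈ Ideal.span {g ∈ s | g.totalDegree ≤ D} := by
  rw [← homogeneousComponent_eq_self hf]
  clear hf
  induction h using Submodule.span_induction with
  | mem g hg =>
    obtain ⟨e, he⟩ := hs g hg
    rw [homogeneousComponent_of_mem he]
    split_ifs with hD
    · exact Ideal.subset_span ⟨hg, hD ▸ he.totalDegree_le⟩
    · exact zero_mem _
  | zero => simp
  | add x y _ _ hx hy => rw [map_add]; exact add_mem hx hy
  | smul p x hxs hx =>
    -- The hypothesis on the degree D part of `x` says nothing about that of `p • x`, so the claim
    -- is proved for all multiples by a second induction.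
    clear hx
    revert p
    induction hxs using Submodule.span_induction with
    | mem g hg =>
      intro p
      obtain ⟨e, he⟩ := hs g hg
      rw [smul_eq_mul, homogeneousComponent_mul_of_isHomogeneous he]
      rcases shiftedComponent_isHomogeneous e D p with h0 | ⟨c, hc, -⟩
      · simp [h0]
      · exact Ideal.mul_mem_left _ _ (Ideal.subset_span ⟨hg, by have := he.totalDegree_le; omega⟩)
    | zero => simp
    | add x y _ _ hx hy => intro p; rw [smul_add, map_add]; exact add_mem (hx p) (hy p)
    | smul q x _ hx => intro p; rw [smul_smul]; exact hx _

variable {ι κ : Type*}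

/-- `y` is homogeneous of degree `D` in the graded free module with basis degrees `δ`. -/
def IsHomogeneousVector (δ : ι → ℕ) (D : ℕ) (y : ι → MvPolynomial σ k) : Prop :=
  ∀ β, y β = 0 ∨ ∃ c : ℕ, δ β + c = D ∧ (y β).IsHomogeneous c

/-- The component of degree `D` in the graded free module with basis degrees `δ`. -/
noncomputable def vectorComponent (δ : ι → ℕ) (D : ℕ) :
    (ι → MvPolynomial σ k) →ₗ[k] (ι → MvPolynomial σ k) :=
  LinearMap.pi fun β => shiftedComponent (δ β) D ∘ₗ LinearMap.proj β

@[simp]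
theorem vectorComponent_apply (δ : ι → ℕ) (D : ℕ) (x : ι → MvPolynomial σ k) (β : ι) :
    vectorComponent δ D x β = shiftedComponent (δ β) D (x β) := rfl

theorem vectorComponent_isHomogeneousVector (δ : ι → ℕ) (D : ℕ) (x : ι → MvPolynomial σ k) :
    IsHomogeneousVector δ D (vectorComponent δ D x) := fun _ =>
  shiftedComponent_isHomogeneous _ _ _

theorem vectorComponent_smul {δ : ι → ℕ} {D : ℕ} {y : ι → MvPolynomial σ k}
    (hy : IsHomogeneousVector δ D y) (E : ℕ) (p : MvPolynomial σ k) :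
    vectorComponent δ E (p • y) = shiftedComponent D E p • y := by
  funext β
  rcases hy β with h | ⟨c, rfl, hc⟩
  · simp [h]
  · simp [shiftedComponent_mul_of_isHomogeneous hc]

theorem vectorComponent_map [Fintype κ] [DecidableEq κ] {δ : ι → ℕ} {D : κ → ℕ}
    (f : (κ → MvPolynomial σ k) →ₗ[MvPolynomial σ k] (ι → MvPolynomial σ k))
    (hf : ∀ i, IsHomogeneousVector δ (D i) (f (Pi.single i 1))) (E : ℕ)
    (x : κ → MvPolynomial σ k) :
    vectorComponent δ E (f x) = f (vectorComponent D E x) := by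
  have h : ∀ z : κ → MvPolynomial σ k, f z = ∑ i, z i • f (Pi.single i 1) := fun z => by
    conv_lhs => rw [pi_eq_sum_univ' z, map_sum]
    simp only [map_smul]
  rw [h x, h, map_sum]
  exact Finset.sum_congr rfl fun i _ => vectorComponent_smul (hf i) E _

theorem sum_vectorComponent [Fintype ι] (δ : ι → ℕ) (x : ι → MvPolynomial σ k) :
    ∃ B, ∑ E ∈ Finset.range B, vectorComponent δ E x = x := by
  refine ⟨(Finset.univ.sup fun β => δ β + (x β).totalDegree) + 1, ?_⟩
  funext β
  have hB : δ β + (x β).totalDegree ≤ Finset.univ.sup fun β => δ β + (x β).totalDegree :=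
    Finset.le_sup (f := fun β => δ β + (x β).totalDegree) (Finset.mem_univ β)
  generalize (Finset.univ.sup fun β => δ β + (x β).totalDegree) = B at hB
  obtain ⟨m, rfl⟩ := Nat.exists_eq_add_of_le (show δ β ≤ B by omega)
  rw [Finset.sum_apply, add_assoc, Finset.sum_range_add]
  rw [Finset.sum_eq_zero, zero_add]
  · have : ∀ i, vectorComponent δ (δ β + i) x β = homogeneousComponent i (x β) := fun i => by
      simp [shiftedComponent]
    simp only [this]
    conv_rhs => rw [← sum_homogeneousComponent (x β)]
    symm
    apply Finset.sum_subset
    · exact Finset.range_mono (by omega)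
    · intro i _ hi
      exact homogeneousComponent_eq_zero _ _ (by simpa using hi)
  · intro i hi
    have : ¬ δ β ≤ i := by simpa using hi
    simp [shiftedComponent, this]

/-- A submodule of a graded free module that contains the components of its elements. -/
def IsGradedSubmodule (δ : ι → ℕ)
    (N : Submodule (MvPolynomial σ k) (ι → MvPolynomial σ k)) : Prop :=
  ∀ x ∈ N, ∀ E, vectorComponent δ E x ∈ N

theorem exists_homogeneous_generators [Finite σ] [Fintype ι] {δ : ι → ℕ}
    {N : Submodule (MvPolynomial σ k) (ι → MvPolynomial σ k)} (hN : IsGradedSubmodule δ N) :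
    ∃ (s : ℕ) (D : Fin s → ℕ) (y : Fin s → ι → MvPolynomial σ k),
      (∀ i, IsHomogeneousVector δ (D i) (y i)) ∧
      Submodule.span (MvPolynomial σ k) (Set.range y) = N := by
  classical
  obtain ⟨t, ht⟩ := IsNoetherian.noetherian N
  choose B hB using fun x : ι → MvPolynomial σ k => sum_vectorComponent δ x
  let u : Finset ((ι → MvPolynomial σ k) × ℕ) :=
    t.biUnion fun x => (Finset.range (B x)).image fun E => (x, E)
  let e := u.equivFin
  refine ⟨u.card, fun i => (e.symm i).1.2,
    fun i => vectorComponent δ (e.symm i).1.2 (e.symm i).1.1,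
    fun i => vectorComponent_isHomogeneousVector _ _ _, le_antisymm ?_ ?_⟩
  · rw [Submodule.span_le]
    rintro _ ⟨i, rfl⟩
    have hi := (e.symm i).2
    simp only [u, Finset.mem_biUnion, Finset.mem_image] at hi
    obtain ⟨x, hx, E, -, hE⟩ := hi
    refine hN _ ?_ _
    rw [← hE, ← ht]
    exact Submodule.subset_span hx
  · rw [← ht, Submodule.span_le]
    intro x hx
    rw [SetLike.mem_coe, ← hB x]
    refine sum_mem fun E hE => Submodule.subset_span ?_
    have hu : (x, E) ∈ u := by
      simp only [u, Finset.mem_biUnion, Finset.mem_image]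
      exact ⟨x, hx, E, hE, rfl⟩
    exact ⟨e ⟨_, hu⟩, by simp⟩

/-- Choose the number of homogeneous generators as small as possible. A relation with a nonzero
constant term in some coefficient would make that generator redundant, as in the graded Nakayama
lemma. -/
theorem exists_minimal_homogeneous_generators [Finite σ] [Fintype ι] {δ : ι → ℕ}
    {N : Submodule (MvPolynomial σ k) (ι → MvPolynomial σ k)} (hN : IsGradedSubmodule δ N) :
    ∃ (s : ℕ) (D : Fin s → ℕ) (y : Fin s → ι → MvPolynomial σ k),
      (∀ i, IsHomogeneousVector δ (D i) (y i)) ∧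
      Submodule.span (MvPolynomial σ k) (Set.range y) = N ∧
      ∀ p : Fin s → MvPolynomial σ k, ∑ i, p i • y i = 0 → ∀ i, constantCoeff (p i) = 0 := by
  classical
  have hex := exists_homogeneous_generators hN
  obtain ⟨D, y, hy, hspan⟩ := Nat.find_spec hex
  have hmin := fun m => @Nat.find_min _ _ hex m
  generalize Nat.find hex = s at *
  refine ⟨s, D, y, hy, hspan, fun p hp i₀ => ?_⟩
  by_contra hne
  cases s with
  | zero => exact i₀.elim0
  | succ s =>
    refine hmin s (Nat.lt_succ_self s) ⟨fun i => D (i₀.succAbove i), fun i => y (i₀.succAbove i),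
      fun i => hy _, ?_⟩
    refine le_antisymm ?_ ?_
    · rw [← hspan]
      exact Submodule.span_mono (Set.range_comp_subset_range i₀.succAbove y)
    · rw [← hspan, Submodule.span_le]
      rintro _ ⟨i, rfl⟩
      rcases Fin.eq_self_or_eq_succAbove i₀ i with rfl | ⟨j, rfl⟩
      -- In the degree of `y i` the coefficient of `y i` is just the constant term of `p i`, which
      -- is invertible.
      · have h := congrArg (vectorComponent δ (D i)) hp
        rw [map_sum, map_zero, Fin.sum_univ_succAbove _ i, vectorComponent_smul (hy i)] at h
        have hc : shiftedComponent (D i) (D i) (p i) = C (constantCoeff (p i)) := by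
          simp [shiftedComponent, constantCoeff_eq]
        rw [hc] at h
        have hy' : y i = C (σ := σ) (constantCoeff (p i))⁻¹ •
            (-∑ j, vectorComponent δ (D i) (p (i.succAbove j) • y (i.succAbove j))) := by
          rw [← eq_neg_of_add_eq_zero_left h, smul_smul, ← C_mul, inv_mul_cancel₀ hne, C_1,
            one_smul]
        rw [SetLike.mem_coe, hy']
        refine Submodule.smul_mem _ _ (neg_mem (sum_mem fun j _ => ?_))
        rw [vectorComponent_smul (hy _)]
        exact Submodule.smul_mem _ _ (Submodule.subset_span ⟨j, rfl⟩)
      · exact Submodule.subset_span ⟨j, rfl⟩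

/-- A graded submodule of a graded free module of finite rank. -/
structure GradedStage (σ k : Type*) [Field k] where
  rank : ℕ
  deg : Fin rank → ℕ
  sub : Submodule (MvPolynomial σ k) (Fin rank → MvPolynomial σ k)
  graded : IsGradedSubmodule deg sub

namespace GradedStage

variable [Finite σ] (T : GradedStage σ k)

/-- The number of minimal generators. -/
noncomputable def genCard : ℕ := (exists_minimal_homogeneous_generators T.graded).choose

/-- The degrees of the minimal generators. -/
noncomputable def genDeg : Fin T.genCard → ℕ :=
  (exists_minimal_homogeneous_generators T.graded).choose_spec.choose

/-- Minimal homogeneous generators. -/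
noncomputable def gen : Fin T.genCard → Fin T.rank → MvPolynomial σ k :=
  (exists_minimal_homogeneous_generators T.graded).choose_spec.choose_spec.choose

theorem gen_spec : (∀ i, IsHomogeneousVector T.deg (T.genDeg i) (T.gen i)) ∧
    Submodule.span (MvPolynomial σ k) (Set.range T.gen) = T.sub ∧
    ∀ p : Fin T.genCard → MvPolynomial σ k,
      ∑ i, p i • T.gen i = 0 → ∀ i, constantCoeff (p i) = 0 :=
  (exists_minimal_homogeneous_generators T.graded).choose_spec.choose_spec.choose_spec

/-- The minimal free cover. -/
noncomputable def cover :
    (Fin T.genCard → MvPolynomial σ k) →ₗ[MvPolynomial σ k] (Fin T.rank → MvPolynomial σ k) :=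
  Fintype.linearCombination (MvPolynomial σ k) T.gen

theorem cover_single (i : Fin T.genCard) : T.cover (Pi.single i 1) = T.gen i := by
  simp [cover, Fintype.linearCombination_apply_single]

theorem range_cover : LinearMap.range T.cover = T.sub := by
  rw [cover, Fintype.range_linearCombination, T.gen_spec.2.1]

/-- The kernel of the minimal free cover. -/
noncomputable def next : GradedStage σ k where
  rank := T.genCard
  deg := T.genDeg
  sub := LinearMap.ker T.cover
  graded := fun x hx E => by
    rw [LinearMap.mem_ker] at hx ⊢
    rw [← vectorComponent_map (δ := T.deg) T.cover
      (fun i => by rw [cover_single]; exact T.gen_spec.1 i), hx, map_zero]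

/-- A generator of the next stage is a relation between minimal generators of this one. -/
theorem gen_next_minimal (i : Fin T.next.genCard) (β : Fin T.genCard) :
    constantCoeff (T.next.gen i β) = 0 := by
  have h : T.next.gen i ∈ T.next.sub := by
    rw [← T.next.gen_spec.2.1]
    exact Submodule.subset_span ⟨i, rfl⟩
  refine T.gen_spec.2.2 _ ?_ β
  exact h

/-- The iterated kernels of minimal free covers. -/
noncomputable def iterate : ℕ → GradedStage σ k
  | 0 => T
  | i + 1 => (iterate i).next

end GradedStage

theorem GradedStage.nonempty_minimalResolution [Finite σ] (T : GradedStage σ k)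
    (e : Fin T.rank) (he : ∀ j, j = e) (hdeg : T.deg e = 0) {I : Ideal (MvPolynomial σ k)}
    (hI : T.sub = Submodule.comap (LinearMap.proj e) I) : Nonempty (MinimalResolution I) := by
  have h1 : LinearMap.range (LinearMap.proj e ∘ₗ T.cover) = I := by
    rw [LinearMap.range_comp, T.range_cover, hI]
    exact Submodule.map_comap_eq_of_surjective (fun x => ⟨fun _ => x, rfl⟩) _
  have h2 : LinearMap.ker T.cover = LinearMap.ker (LinearMap.proj e ∘ₗ T.cover) := by
    ext x
    rw [LinearMap.mem_ker, LinearMap.mem_ker, LinearMap.comp_apply, LinearMap.proj_apply]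
    refine ⟨fun hx => by rw [hx]; rfl, fun hx => ?_⟩
    funext j
    rw [he j]
    exact hx
  have h3 : ∀ α, ((LinearMap.proj e ∘ₗ T.cover) (Pi.single α 1)).IsHomogeneous (T.genDeg α) := by
    intro α
    rw [LinearMap.comp_apply, LinearMap.proj_apply, T.cover_single]
    rcases T.gen_spec.1 α e with h | ⟨c, hc, h⟩
    · rw [h]; exact isHomogeneous_zero _ _ _
    · rw [hdeg, zero_add] at hc
      rw [← hc]; exact h
  refine ⟨{
    rank := fun i => (T.iterate i).genCard
    deg := fun i => (T.iterate i).genDeg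
    aug := LinearMap.proj e ∘ₗ T.cover
    d := fun i => (T.iterate (i + 1)).cover
    range_aug := h1
    exact_zero := (T.iterate 1).range_cover.trans h2
    exact_succ := fun i => (T.iterate (i + 2)).range_cover
    aug_homogeneous := h3
    d_homogeneous := fun i α β => ?_
    d_minimal := fun i α β => ?_ }⟩
  · have h := (T.iterate (i + 1)).gen_spec.1 α β
    rw [← (T.iterate (i + 1)).cover_single] at h
    exact h
  · have h := (T.iterate i).gen_next_minimal α β
    change constantCoeff ((T.iterate (i + 1)).cover (Pi.single α 1) β) = 0
    rw [(T.iterate (i + 1)).cover_single]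
    exact h

/-- Without a resolution every `m` would satisfy `IsRegular I m` vacuously, and no lower bound for
`regularity` could hold. -/
theorem nonempty_minimalResolution [Finite σ] (I : Ideal (MvPolynomial σ k))
    (hI : ∀ f ∈ I, ∀ D, homogeneousComponent D f ∈ I) : Nonempty (MinimalResolution I) := by
  let T : GradedStage σ k :=
    { rank := 1
      deg := 0
      sub := Submodule.comap (LinearMap.proj 0) I
      graded := fun x hx E => by simpa [shiftedComponent] using hI _ hx E }
  exact T.nonempty_minimalResolution (0 : Fin 1) (fun _ => Subsingleton.elim (α := Fin 1) _ _)
    rfl rfl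

end GradedModules

end MayrMeyer

namespace MayrMeyer

open MvPolynomial

/-! ### Homogenization and dehomogenization. -/

section Homogenization

variable {σ k : Type*} [Field k]

/-- Homogenization to a prescribed degree `D`. -/
noncomputable def homogenizeTo (D : ℕ) :
    MvPolynomial σ k →ₗ[k] MvPolynomial (Option σ) k :=
  (basisMonomials σ k).constr k fun a => rename some (monomial a 1) * X none ^ (D - a.degree)

theorem homogenizeTo_monomial (D : ℕ) (a : σ →₀ ℕ) (c : k) :
    homogenizeTo D (monomial a c) = rename some (monomial a c) * X none ^ (D - a.degree) := by
  have h : (monomial a c : MvPolynomial σ k) = c • basisMonomials σ k a := by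
    simp [smul_monomial]
  rw [h, map_smul, homogenizeTo, Module.Basis.constr_basis, coe_basisMonomials, map_smul,
    smul_mul_assoc]

theorem homogenize_isHomogeneous (f : MvPolynomial σ k) :
    (homogenize f).IsHomogeneous f.totalDegree := by
  refine IsHomogeneous.sum _ _ _ fun a ha => ?_
  have h1 : (rename some (monomial a (f.coeff a)) : MvPolynomial (Option σ) k).IsHomogeneous
      a.degree := (isHomogeneous_monomial _ rfl).rename_isHomogeneous
  have h2 := h1.mul (isHomogeneous_X_pow (R := k) (none : Option σ) (f.totalDegree - a.degree))
  have h3 : a.degree ≤ f.totalDegree := le_totalDegree ha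
  rwa [Nat.add_sub_cancel' h3] at h2

/-- The substitution of `1` for the homogenizing variable. -/
noncomputable def dehomogenize : MvPolynomial (Option σ) k →ₐ[k] MvPolynomial σ k :=
  aeval fun o => o.elim 1 X

theorem dehomogenize_rename_some (f : MvPolynomial σ k) :
    dehomogenize (rename some f) = f := by
  rw [dehomogenize, aeval_rename]
  exact aeval_X_left_apply f

theorem dehomogenize_X_none : dehomogenize (X none : MvPolynomial (Option σ) k) = 1 := by
  simp [dehomogenize]

theorem dehomogenize_X_some (v : σ) :
    dehomogenize (X (some v) : MvPolynomial (Option σ) k) = X v := by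
  simp [dehomogenize]

theorem dehomogenize_homogenize (f : MvPolynomial σ k) : dehomogenize (homogenize f) = f := by
  simp only [homogenize, map_sum, map_mul, map_pow, dehomogenize_rename_some,
    dehomogenize_X_none, one_pow, mul_one]
  exact f.as_sum.symm

theorem totalDegree_dehomogenize_le (f : MvPolynomial (Option σ) k) :
    (dehomogenize f).totalDegree ≤ f.totalDegree := by
  have key : ∀ d : Option σ →₀ ℕ,
      (d.prod fun i n => (i.elim 1 X : MvPolynomial σ k) ^ n).totalDegree ≤ d.degree := by
    intro d
    refine (totalDegree_finsetProd _ _).trans (Finset.sum_le_sum fun i _ => ?_)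
    refine (totalDegree_pow _ _).trans ?_
    cases i <;> simp
  conv_lhs => rw [f.as_sum, map_sum]
  refine (totalDegree_finsetSum _ _).trans (Finset.sup_le fun d hd => ?_)
  rw [dehomogenize, aeval_monomial]
  refine (totalDegree_mul _ _).trans ?_
  rw [algebraMap_eq, totalDegree_C, zero_add]
  exact (key d).trans (le_totalDegree hd)

theorem homogenizeTo_monomial_mul {D : ℕ} (a : σ →₀ ℕ) (c : k) (g : MvPolynomial σ k)
    (hD : a.degree + g.totalDegree ≤ D) :
    homogenizeTo D (monomial a c * g) =
      rename some (monomial a c) * X none ^ (D - a.degree - g.totalDegree) * homogenize g := by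
  conv_lhs => rw [g.as_sum, Finset.mul_sum, map_sum]
  rw [homogenize, Finset.mul_sum]
  refine Finset.sum_congr rfl fun b hb => ?_
  have hb' : b.degree ≤ g.totalDegree := le_totalDegree hb
  rw [monomial_mul, homogenizeTo_monomial, ← monomial_mul, map_mul, map_add]
  have : D - (a.degree + b.degree) =
      (D - a.degree - g.totalDegree) + (g.totalDegree - b.degree) := by omega
  rw [this, pow_add]
  ring

/-- Once D exceeds the degrees of all terms in an expression of `f` by the generators, the
expression can be homogenized term by term. Small D must be excluded, because cancellation may leave
`f` of lower degree than these terms. -/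
theorem homogenizeTo_mem_span {G : Set (MvPolynomial σ k)} {f : MvPolynomial σ k}
    (hf : f ∈ Ideal.span G) :
    ∃ D₀, ∀ D, D₀ ≤ D → homogenizeTo D f ∈ Ideal.span (homogenize '' G) := by
  induction hf using Submodule.span_induction with
  | mem g hg =>
    refine ⟨g.totalDegree, fun D hD => ?_⟩
    have := homogenizeTo_monomial_mul (D := D) 0 1 g (by simpa using hD)
    rw [monomial_zero', C_1, one_mul] at this
    rw [this]
    exact Ideal.mul_mem_left _ _ (Ideal.subset_span ⟨g, hg, rfl⟩)
  | zero => exact ⟨0, fun D _ => by simp⟩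
  | add x y _ _ hx hy =>
    obtain ⟨a, ha⟩ := hx
    obtain ⟨b, hb⟩ := hy
    exact ⟨max a b, fun D hD => by
      rw [map_add]
      exact add_mem (ha D (le_of_max_le_left hD)) (hb D (le_of_max_le_right hD))⟩
  | smul p x hxs hx =>
    clear hx
    revert p
    induction hxs using Submodule.span_induction with
    | mem g hg =>
      intro p
      induction p using MvPolynomial.induction_on' with
      | monomial a c =>
        refine ⟨a.degree + g.totalDegree, fun D hD => ?_⟩
        rw [smul_eq_mul, homogenizeTo_monomial_mul _ _ _ hD]
        exact Ideal.mul_mem_left _ _ (Ideal.subset_span ⟨g, hg, rfl⟩)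
      | add p q hp hq =>
        obtain ⟨a, ha⟩ := hp
        obtain ⟨b, hb⟩ := hq
        exact ⟨max a b, fun D hD => by
          rw [add_smul, map_add]
          exact add_mem (ha D (le_of_max_le_left hD)) (hb D (le_of_max_le_right hD))⟩
    | zero => exact fun p => ⟨0, fun D _ => by simp⟩
    | add x y _ _ hx hy =>
      intro p
      obtain ⟨a, ha⟩ := hx p
      obtain ⟨b, hb⟩ := hy p
      exact ⟨max a b, fun D hD => by
        rw [smul_add, map_add]
        exact add_mem (ha D (le_of_max_le_left hD)) (hb D (le_of_max_le_right hD))⟩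
    | smul q x _ hx =>
      intro p
      rw [smul_smul]
      exact hx _

end Homogenization

/-! ### The generating degree of an ideal with given homogeneous generators. -/

section GeneratingDegree

variable {σ k : Type*} [Field k]

attribute [local instance] MvPolynomial.gradedAlgebra in
theorem homogeneousComponent_mem_span {s : Set (MvPolynomial σ k)}
    (hs : ∀ g ∈ s, ∃ e, g.IsHomogeneous e) {f : MvPolynomial σ k} (hf : f ∈ Ideal.span s)
    (D : ℕ) : homogeneousComponent D f ∈ Ideal.span s :=
  homogeneousComponent_mem_of_mem (Ideal.homogeneous_span _ _ hs) hf D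

theorem exists_isMinimalGeneratingSet [Finite σ] {G : Set (MvPolynomial σ k)}
    (hG : ∀ g ∈ G, ∃ e, g.IsHomogeneous e) :
    ∃ s, IsMinimalGeneratingSet (Ideal.span G) s := by
  classical
  obtain ⟨t, htG, ht⟩ := (Submodule.fg_span_iff_fg_span_finset_subset G).1
    (IsNoetherian.noetherian (Ideal.span G))
  obtain ⟨s, hst, hs⟩ := exists_minimal_le_of_wellFoundedLT
    (fun u : Finset (MvPolynomial σ k) => u ⊆ t ∧ Ideal.span (u : Set (MvPolynomial σ k)) =
      Ideal.span G) t ⟨subset_rfl, ht.symm⟩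
  refine ⟨s, ⟨fun f hf => hG f (htG (hst hf)), hs.prop.2⟩, fun u hu hus => ?_⟩
  have hfin : u.Finite := s.finite_toSet.subset hus
  have h := hs.le_of_le (y := hfin.toFinset)
    ⟨fun f hf => hst (hus (by simpa using hf)), by simpa using hu.2⟩
    (fun f hf => hus (by simpa using hf))
  intro f hf
  simpa using h hf

/-- By degree comparison, the elements of degree at most d + 1 of a minimal set already generate, so
minimality leaves no others. If all of them had degree at most d, the same comparison would let the
generators in `G` of degree at most d suffice. -/
theorem generatingDegree_span [Finite σ] {G : Set (MvPolynomial σ k)} {d : ℕ}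
    (hG : ∀ g ∈ G, ∃ e, g.IsHomogeneous e) (hd : ∀ g ∈ G, g.totalDegree ≤ d + 1)
    (hlow : ¬ Ideal.span G ≤ Ideal.span {g ∈ G | g.totalDegree ≤ d}) :
    generatingDegree (Ideal.span G) = (d + 1 : ℕ) := by
  refine le_antisymm ?_ ?_
  · refine iSup_le fun s => iSup_le fun hs => iSup₂_le fun f hf => ?_
    have hle : Ideal.span G ≤ Ideal.span {g ∈ s | g.totalDegree ≤ d + 1} := by
      refine Ideal.span_le.2 fun g hg => ?_
      obtain ⟨e, he⟩ := hG g hg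
      have he' : g.IsHomogeneous g.totalDegree := by
        rcases eq_or_ne g 0 with rfl | h0
        · exact isHomogeneous_zero _ _ _
        · rwa [he.totalDegree h0]
      refine Ideal.span_mono ?_ (mem_span_of_totalDegree_le hs.prop.1 he'
        (hs.prop.2 ▸ Ideal.subset_span hg))
      exact fun x hx => ⟨hx.1, hx.2.trans (hd g hg)⟩
    have := hs.le_of_le (y := {g ∈ s | g.totalDegree ≤ d + 1})
      ⟨fun g hg => hs.prop.1 g hg.1,
        le_antisymm ((Ideal.span_mono (Set.sep_subset _ _)).trans hs.prop.2.le) hle⟩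
      (fun g hg => hg.1) hf
    exact_mod_cast this.2
  · obtain ⟨s, hs⟩ := exists_isMinimalGeneratingSet hG
    by_contra hlt
    refine hlow ?_
    rw [← hs.prop.2, Ideal.span_le]
    intro f hf
    have hfd : f.totalDegree ≤ d := by
      by_contra hfd
      refine hlt (le_trans ?_ (le_iSup₂_of_le s hs (le_iSup₂_of_le f hf le_rfl)))
      exact_mod_cast not_le.1 hfd
    obtain ⟨e, he⟩ := hs.prop.1 f hf
    rcases eq_or_ne f 0 with rfl | h0
    · exact zero_mem _
    · have := mem_span_of_totalDegree_le hG he (hs.prop.2 ▸ Ideal.subset_span hf)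
      rw [← he.totalDegree h0] at this
      refine Ideal.span_mono ?_ this
      exact fun x hx => ⟨hx.1, hx.2.trans hfd⟩

end GeneratingDegree

/-! ### The generating degree of J is 4. -/

section MayrMeyerDegree

variable (k : Type*) [Field k] (n : ℕ)

instance finite_var : Finite (Var n) := by
  refine Finite.of_surjective
    (fun x : (Fin (n + 1) ⊕ Fin (n + 1)) ⊕ (Fin (n + 1) × Fin 4 ⊕ Fin (n + 1) × Fin 4) =>
      match x with
      | .inl (.inl m) => Var.S m
      | .inl (.inr m) => Var.F m
      | .inr (.inl p) => Var.C p.1 p.2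
      | .inr (.inr p) => Var.B p.1 p.2) ?_
  rintro (m | m | ⟨m, i⟩ | ⟨m, i⟩)
  · exact ⟨.inl (.inl m), rfl⟩
  · exact ⟨.inl (.inr m), rfl⟩
  · exact ⟨.inr (.inl (m, i)), rfl⟩
  · exact ⟨.inr (.inr (m, i)), rfl⟩

theorem totalDegree_generators_le {g : MvPolynomial (Var n) k} (hg : g ∈ generators k n) :
    g.totalDegree ≤ 4 := by
  have hsub : ∀ (p q : MvPolynomial (Var n) k) (a : ℕ), p.totalDegree ≤ a → q.totalDegree ≤ a →
      (p - q).totalDegree ≤ a := fun p q a hp hq => (totalDegree_sub _ _).trans (max_le hp hq)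
  have hmul : ∀ (p q : MvPolynomial (Var n) k) (a b : ℕ), p.totalDegree ≤ a →
      q.totalDegree ≤ b → (p * q).totalDegree ≤ a + b :=
    fun p q a b hp hq => (totalDegree_mul _ _).trans (add_le_add hp hq)
  have hX : ∀ v : Var n, (X v : MvPolynomial (Var n) k).totalDegree ≤ 1 :=
    fun v => (totalDegree_X v).le
  have h2 : ∀ u v : Var n, (X u * X v : MvPolynomial (Var n) k).totalDegree ≤ 2 :=
    fun u v => hmul _ _ 1 1 (hX u) (hX v)
  have h3 : ∀ u v w : Var n, (X u * X v * X w : MvPolynomial (Var n) k).totalDegree ≤ 3 :=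
    fun u v w => hmul _ _ 2 1 (h2 u v) (hX w)
  have h4 : ∀ u v w z : Var n, (X u * X v * X w * X z : MvPolynomial (Var n) k).totalDegree ≤ 4 :=
    fun u v w z => hmul _ _ 3 1 (h3 u v w) (hX z)
  rcases hg with (hg | hg) | ⟨i, rfl⟩
  · obtain ⟨m, hg⟩ := Set.mem_iUnion.1 hg
    rcases hg with (rfl | rfl) | ⟨i, rfl⟩
    · exact hsub _ _ _ ((hX _).trans (by omega)) ((h2 _ _).trans (by omega))
    · exact hsub _ _ _ ((hX _).trans (by omega)) ((h2 _ _).trans (by omega))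
    · exact hsub _ _ _ ((h3 _ _ _).trans (by omega)) (h4 _ _ _ _)
  · obtain ⟨m, hg⟩ := Set.mem_iUnion.1 hg
    rcases hg with rfl | rfl | rfl | rfl
    · exact hsub _ _ _ ((h3 _ _ _).trans (by omega)) ((h2 _ _).trans (by omega))
    · exact hsub _ _ _ ((h2 _ _).trans (by omega)) ((h2 _ _).trans (by omega))
    · exact hsub _ _ _ ((h3 _ _ _).trans (by omega)) ((h3 _ _ _).trans (by omega))
    · exact hsub _ _ _ ((h2 _ _).trans (by omega)) ((h3 _ _ _).trans (by omega))
  · refine hsub _ _ _ ((h2 _ _).trans (by omega)) ?_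
    rw [pow_two, ← mul_assoc]
    exact h4 _ _ _ _

/-- The standard homogeneous generators of `J_n^H`. -/
def homogeneousGenerators : Set (MvPolynomial (Option (Var n)) k) :=
  {X (some (Var.S (Fin.last n))), X (some (Var.F (Fin.last n)))} ∪ homogenize '' generators k n

theorem idealJ_eq_span : idealJ k n = Ideal.span (homogeneousGenerators k n) :=
  (Ideal.span_union _ _).symm

theorem homogeneousGenerators_isHomogeneous (g : MvPolynomial (Option (Var n)) k)
    (hg : g ∈ homogeneousGenerators k n) : ∃ e ≤ 4, g.IsHomogeneous e := by
  rcases hg with (rfl | rfl) | ⟨g, hg, rfl⟩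
  · exact ⟨1, by omega, isHomogeneous_X _ _⟩
  · exact ⟨1, by omega, isHomogeneous_X _ _⟩
  · exact ⟨_, totalDegree_generators_le k n hg, homogenize_isHomogeneous g⟩

/-- A point where all generators of degree at most three vanish. -/
def testPoint : Var n → k
  | .S _ => 0
  | .F m => if m = 0 then 1 else 0
  | .C m i => if m = 0 ∧ (i = 1 ∨ i = 2) then 1 else 0
  | .B m i => if m = 0 ∧ i = 1 then 1 else 0

theorem eval_testPoint_generators {g : MvPolynomial (Var n) k} (hg : g ∈ generators k n) :
    eval (testPoint k n) g = 0 ∨ g = vC k 0 1 * vS k 0 - vC k 0 1 * vF k 0 * vB k 0 1 ^ 2 := by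
  rcases hg with (hg | hg) | ⟨i, rfl⟩
  · left
    obtain ⟨m, hg⟩ := Set.mem_iUnion.1 hg
    rcases hg with (rfl | rfl) | ⟨i, rfl⟩ <;>
      simp [vS, vF, vC, vB, testPoint, Fin.succ_ne_zero]
  · left
    obtain ⟨m, hg⟩ := Set.mem_iUnion.1 hg
    rcases hg with rfl | rfl | rfl | rfl <;> simp [vS, vF, vC, vB, testPoint]
  · by_cases hi : i = 1
    · right; rw [hi]
    · left; simp [vS, vF, vC, vB, testPoint, hi]

theorem four_le_totalDegree_base :
    4 ≤ (vC k 0 1 * vS k 0 - vC k 0 1 * vF k 0 * vB k 0 1 ^ 2 :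
      MvPolynomial (Var n) k).totalDegree := by
  classical
  let d : Var n →₀ ℕ := Finsupp.single (Var.C 0 1) 1 + Finsupp.single (Var.F 0) 1 +
    Finsupp.single (Var.B 0 1) 2
  have h1 : (vC k 0 1 * vF k 0 * vB k 0 1 ^ 2 : MvPolynomial (Var n) k) = monomial d 1 := by
    simp only [vC, vF, vB, X, monomial_mul, monomial_pow, d]
    simp
  have h2 : (vC k 0 1 * vS k 0 : MvPolynomial (Var n) k) =
      monomial (Finsupp.single (Var.C 0 1) 1 + Finsupp.single (Var.S 0) 1) 1 := by
    simp only [vC, vS, X, monomial_mul, one_mul]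
  have hne : Finsupp.single (Var.C 0 1) 1 + Finsupp.single (Var.S 0) 1 ≠ d := fun h => by
    simpa [d, Finsupp.single_apply] using DFunLike.congr_fun h (Var.S 0)
  have hdeg : d.degree = 4 := by simp [d, map_add, Finsupp.degree_single]
  refine hdeg.symm.le.trans (le_totalDegree ?_)
  rw [mem_support_iff, h1, h2, coeff_sub, coeff_monomial, coeff_monomial, if_neg hne, if_pos rfl]
  simp

theorem generatingDegree_idealJ (hn : 1 ≤ n) : generatingDegree (idealJ k n) = 4 := by
  rw [idealJ_eq_span]
  refine generatingDegree_span (d := 3)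
    (fun g hg => (homogeneousGenerators_isHomogeneous k n g hg).imp fun e he => he.2)
    (fun g hg => ?_) fun hle => ?_
  · obtain ⟨e, he4, he⟩ := homogeneousGenerators_isHomogeneous k n g hg
    exact he.totalDegree_le.trans he4
  · let φ : MvPolynomial (Option (Var n)) k →+* k :=
      (eval (testPoint k n)).comp (dehomogenize (σ := Var n) (k := k)).toRingHom
    -- For n = 0 the generator F^(n) would be F^(0), which is 1 at the test point.
    have hlast : Fin.last n ≠ 0 := by
      rw [Ne, Fin.ext_iff]; simp; omega
    have hker : Ideal.span {g ∈ homogeneousGenerators k n | g.totalDegree ≤ 3} ≤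
        RingHom.ker φ := by
      rw [Ideal.span_le]
      rintro g ⟨(rfl | rfl) | ⟨g, hg, rfl⟩, hdeg⟩
      · change eval (testPoint k n) (dehomogenize (X _)) = 0
        simp [dehomogenize_X_some, testPoint]
      · change eval (testPoint k n) (dehomogenize (X _)) = 0
        simp [dehomogenize_X_some, testPoint, hlast]
      · change eval (testPoint k n) (dehomogenize (homogenize g)) = 0
        rw [dehomogenize_homogenize]
        refine (eval_testPoint_generators k n hg).resolve_right fun h => ?_
        have h4 := four_le_totalDegree_base k n
        rw [← h] at h4
        have h0 : homogenize g ≠ 0 := fun h0 => by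
          have := dehomogenize_homogenize g
          rw [h0, map_zero] at this
          rw [← this, totalDegree_zero] at h4
          omega
        rw [(homogenize_isHomogeneous g).totalDegree h0] at hdeg
        omega
    have hmem : (vC k 0 1 * vS k 0 - vC k 0 1 * vF k 0 * vB k 0 1 ^ 2 :
        MvPolynomial (Var n) k) ∈ generators k n := Or.inr ⟨1, rfl⟩
    have h := hker (hle (Ideal.subset_span (Or.inr ⟨_, hmem, rfl⟩)))
    change eval (testPoint k n) (dehomogenize (homogenize _)) = 0 at h
    rw [dehomogenize_homogenize] at h
    simp [vS, vF, vC, vB, testPoint] at h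

end MayrMeyerDegree

end MayrMeyer

namespace MayrMeyer

/-! ### Monomials as configurations of a counter machine. -/

section Machine

/-- The variables of the Mayr–Meyer ideals, with levels in `ℕ`. -/
inductive LevelVar : Type
  | S (m : ℕ)
  | F (m : ℕ)
  | C (m : ℕ) (i : Fin 4)
  | B (m : ℕ) (i : Fin 4)

namespace LevelVar

open Finsupp

noncomputable instance : DecidableEq LevelVar := Classical.decEq _

/-- The doubly exponential number `2 ^ 2 ^ m`. -/
def height (m : ℕ) : ℕ := 2 ^ 2 ^ m

theorem height_zero : height 0 = 2 := rfl

theorem height_succ (m : ℕ) : height (m + 1) = height m * height m := by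
  rw [height, height, ← pow_add, pow_succ, mul_two]

theorem height_pos (m : ℕ) : 0 < height m := by unfold height; positivity

variable {m n v : ℕ} {w t α β : LevelVar →₀ ℕ}

/-- No variable of a level below `m` occurs. -/
def EmptyBelow (m : ℕ) (w : LevelVar →₀ ℕ) : Prop :=
  ∀ l < m, w (S l) = 0 ∧ w (F l) = 0 ∧ (∀ i, w (C l i) = 0) ∧ ∀ i, w (B l i) = 0

/-- Only variables of levels below `m` occur. -/
def LivesBelow (m : ℕ) (w : LevelVar →₀ ℕ) : Prop :=
  ∀ l, m ≤ l → w (S l) = 0 ∧ w (F l) = 0 ∧ (∀ i, w (C l i) = 0) ∧ ∀ i, w (B l i) = 0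

/-- A monomial `S^(m) ⋯` without variables of lower levels. -/
def AtS (m v : ℕ) (w : LevelVar →₀ ℕ) : Prop :=
  w (S m) = 1 ∧ w (F m) = 0 ∧ v = 0 ∧ EmptyBelow m w

/-- A monomial `F^(m) ⋯` without variables of lower levels. -/
def AtF (m v : ℕ) (w : LevelVar →₀ ℕ) : Prop :=
  w (S m) = 0 ∧ w (F m) = 1 ∧ v = height m ∧ EmptyBelow m w

/-- The relation between the mode `C_j`, the completed counters `q`, and the progress `v` that is
seen by the next level. -/
def Progress (e : ℕ) (j : Fin 4) (q : Fin 4 → ℕ) (v : ℕ) : Prop :=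
  ((j = 0 ∨ j = 3) ∧ q 0 + q 3 = e ∧ q 1 = 0 ∧ q 2 = 0 ∧ v = e * q 3) ∨
  ((j = 1 ∨ j = 2) ∧ q 0 + q 3 + 1 = e ∧ q 1 + q 2 = e ∧ v = e * q 3 + q 2)

/-- Level `m` is in mode `C_j` with completed counters `q`; here `A v` says that the lower levels
have made the progress `v`. -/
def InMode (m : ℕ) (A : ℕ → Prop) (j : Fin 4) (q : Fin 4 → ℕ) (w : LevelVar →₀ ℕ) : Prop :=
  (∀ l, w (C m l) = if l = j then 1 else 0) ∧
  ∃ v ≤ height m, (∀ l, q l = w (B m l) + if l = j then height m - v else 0) ∧ A v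

/-- The levels up to `m` (with the variables `C^(m)`, `B^(m)` left out) have made the progress `v`
on the way from `S^(m)` to `F^(m)`. -/
def Active : ℕ → ℕ → (LevelVar →₀ ℕ) → Prop
  | 0, v, w => AtS 0 v w ∨ AtF 0 v w
  | m + 1, v, w => AtS (m + 1) v w ∨ AtF (m + 1) v w ∨
      (w (S (m + 1)) = 0 ∧ w (F (m + 1)) = 0 ∧
        ∃ j q, Progress (height m) j q v ∧ InMode m (fun v => Active m v w) j q w)

/-- The levels up to `m` are in mode `C_j` with completed counters `q`. -/
def Run (m : ℕ) (j : Fin 4) (q : Fin 4 → ℕ) (w : LevelVar →₀ ℕ) : Prop :=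
  InMode m (fun v => Active m v w) j q w

/-- The levels up to `m` have made the progress `v` seen from level `m + 1`. -/
def Inner (m v : ℕ) (w : LevelVar →₀ ℕ) : Prop :=
  ∃ j q, Progress (height m) j q v ∧ Run m j q w

theorem active_succ_iff : Active (m + 1) v w ↔ AtS (m + 1) v w ∨ AtF (m + 1) v w ∨
    (w (S (m + 1)) = 0 ∧ w (F (m + 1)) = 0 ∧ Inner m v w) := by
  rw [Active]; rfl

/-- With e = `height m`, modes 1 and 2 leave q 3 ≤ e - 1 and q 2 ≤ e, hence v ≤ e(e - 1) + e. -/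
theorem Inner.le (h : Inner m v w) : v ≤ height (m + 1) := by
  obtain ⟨j, q, h, -⟩ := h
  rw [height_succ]
  have := height_pos m
  generalize height m = e at *
  rcases h with ⟨-, h, -, -, rfl⟩ | ⟨-, h, h', rfl⟩
  · exact Nat.mul_le_mul_left e (by omega)
  · obtain ⟨d, rfl⟩ : ∃ d, e = d + 1 := ⟨e - 1, by omega⟩
    have : (d + 1) * q 3 ≤ (d + 1) * d := Nat.mul_le_mul_left _ (by omega)
    rw [mul_add, mul_one]
    omega

theorem active_iff_atS (h : w (S m) ≠ 0) : Active m v w ↔ AtS m v w := by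
  have hF : ¬ AtF m v w := fun hF => h hF.1
  cases m with
  | zero => simp [Active, hF]
  | succ m => simp [active_succ_iff, hF, h]

theorem active_iff_atF (h : w (F m) ≠ 0) : Active m v w ↔ AtF m v w := by
  have hS : ¬ AtS m v w := fun hS => h hS.2.1
  cases m with
  | zero => simp [Active, hS]
  | succ m => simp [active_succ_iff, hS, h]

theorem active_succ_iff_inner (h : ¬ EmptyBelow (m + 1) w) :
    Active (m + 1) v w ↔ w (S (m + 1)) = 0 ∧ w (F (m + 1)) = 0 ∧ Inner m v w := by
  have hS : ¬ AtS (m + 1) v w := fun hS => h hS.2.2.2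
  have hF : ¬ AtF (m + 1) v w := fun hF => h hF.2.2.2
  simp [active_succ_iff, hS, hF]

theorem emptyBelow_add : EmptyBelow m (t + α) ↔ EmptyBelow m t ∧ EmptyBelow m α := by
  simp only [EmptyBelow, Finsupp.add_apply, Nat.add_eq_zero_iff]
  grind

theorem emptyBelow_succ : EmptyBelow (m + 1) w ↔ EmptyBelow m w ∧
    w (S m) = 0 ∧ w (F m) = 0 ∧ (∀ i, w (C m i) = 0) ∧ ∀ i, w (B m i) = 0 := by
  simp only [EmptyBelow, Nat.lt_succ_iff_lt_or_eq]
  grind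

theorem EmptyBelow.mono (h : EmptyBelow n w) (hmn : m ≤ n) : EmptyBelow m w :=
  fun l hl => h l (hl.trans_le hmn)

theorem LivesBelow.mono (h : LivesBelow m w) (hmn : m ≤ n) : LivesBelow n w :=
  fun l hl => h l (hmn.trans hl)

theorem inner_iff_of_S (h : w (S m) ≠ 0) : Inner m v w ↔ AtS m 0 w ∧
    ∃ j, (∀ l, w (C m l) = if l = j then 1 else 0) ∧
      Progress (height m) j (fun l => w (B m l) + if l = j then height m else 0) v := by
  constructor
  · rintro ⟨j, q, hP, hC, u, -, hq, hA⟩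
    have hS := (active_iff_atS h).1 hA
    obtain rfl : u = 0 := hS.2.2.1
    refine ⟨hS, j, hC, ?_⟩
    rwa [← show q = fun l => w (B m l) + if l = j then height m else 0 from funext hq]
  · rintro ⟨hS, j, hC, hP⟩
    exact ⟨j, _, hP, hC, 0, Nat.zero_le _, fun l => rfl, (active_iff_atS h).2 hS⟩

theorem inner_iff_of_F (h : w (F m) ≠ 0) : Inner m v w ↔ AtF m (height m) w ∧
    ∃ j, (∀ l, w (C m l) = if l = j then 1 else 0) ∧
      Progress (height m) j (fun l => w (B m l)) v := by
  constructor
  · rintro ⟨j, q, hP, hC, u, -, hq, hA⟩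
    have hF := (active_iff_atF h).1 hA
    obtain rfl : u = height m := hF.2.2.1
    refine ⟨hF, j, hC, ?_⟩
    rwa [← show q = fun l => w (B m l) from funext fun l => by simp [hq l]]
  · rintro ⟨hF, j, hC, hP⟩
    exact ⟨j, _, hP, hC, height m, le_rfl, fun l => by simp, (active_iff_atF h).2 hF⟩

/-- Level `m` has none of the variables `S`, `F`, `C`, and the lower levels are empty. -/
def Fresh (m : ℕ) (t : LevelVar →₀ ℕ) : Prop :=
  t (S m) = 0 ∧ t (F m) = 0 ∧ (∀ l, t (C m l) = 0) ∧ EmptyBelow m t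

theorem emptyBelow_single_S (c : ℕ) : EmptyBelow m (single (S m) c) := by
  intro l hl; simp [hl.ne']

theorem emptyBelow_single_F (c : ℕ) : EmptyBelow m (single (F m) c) := by
  intro l hl; simp [hl.ne']

theorem emptyBelow_single_C (i : Fin 4) (c : ℕ) : EmptyBelow m (single (C m i) c) := by
  intro l hl; simp [hl.ne']

theorem emptyBelow_single_B (i : Fin 4) (c : ℕ) : EmptyBelow m (single (B m i) c) := by
  intro l hl; simp [hl.ne']

theorem add_ite_eq_ite_iff (x : Fin 4 → ℕ) (a j : Fin 4) :
    (∀ l, x l + (if a = l then 1 else 0) = if l = j then 1 else 0) ↔ j = a ∧ ∀ l, x l = 0 := by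
  constructor
  · intro h
    have h1 := h a
    rw [if_pos rfl] at h1
    have hj : a = j := by
      by_contra hne
      rw [if_neg hne] at h1
      omega
    subst hj
    refine ⟨rfl, fun l => ?_⟩
    have h2 := h l
    by_cases hl : a = l
    · subst hl; simp at h2; exact h2
    · rw [if_neg hl, if_neg (Ne.symm hl)] at h2; omega
  · rintro ⟨rfl, h⟩ l
    rw [h l, zero_add]
    simp [eq_comm]

/-- A factor S^(m) forces the lower progress to be 0, so the whole run is still ahead and counter j
is completed by adding `height m`. Invariance under a loop binomial thereby becomes arithmetic of
exponents. -/
theorem inner_add_S (j i : Fin 4) (c : ℕ) :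
    Inner m v (t + (single (S m) 1 + single (C m j) 1 + single (B m i) c)) ↔
      Fresh m t ∧ Progress (height m) j
        (fun l => t (B m l) + (if i = l then c else 0) + if l = j then height m else 0) v := by
  rw [inner_iff_of_S (by simp)]
  simp only [AtS, Fresh, emptyBelow_add, emptyBelow_single_S, emptyBelow_single_C,
    emptyBelow_single_B, and_true, true_and, Finsupp.add_apply, single_apply, C.injEq,
    B.injEq, reduceCtorEq, if_true, if_false, add_zero, zero_add, add_ite_eq_ite_iff, and_assoc]
  constructor
  · rintro ⟨h1, h2, h3, _, rfl, h4, h5⟩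
    exact ⟨by omega, h2, h4, h3, h5⟩
  · rintro ⟨h1, h2, h4, h3, h5⟩
    exact ⟨by omega, h2, h3, _, rfl, h4, h5⟩

theorem inner_add_F (j i : Fin 4) (c : ℕ) :
    Inner m v (t + (single (F m) 1 + single (C m j) 1 + single (B m i) c)) ↔
      Fresh m t ∧ Progress (height m) j
        (fun l => t (B m l) + (if i = l then c else 0)) v := by
  rw [inner_iff_of_F (by simp)]
  simp only [AtF, Fresh, emptyBelow_add, emptyBelow_single_F, emptyBelow_single_C,
    emptyBelow_single_B, and_true, true_and, Finsupp.add_apply, single_apply, C.injEq,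
    B.injEq, reduceCtorEq, if_true, if_false, add_zero, zero_add, add_ite_eq_ite_iff, and_assoc]
  constructor
  · rintro ⟨h1, h2, h3, _, rfl, h4, h5⟩
    exact ⟨h1, by omega, h4, h3, h5⟩
  · rintro ⟨h1, h2, h4, h3, h5⟩
    exact ⟨h1, by omega, h3, _, rfl, h4, h5⟩

/-! ### Passing invariance to higher levels. -/

/-- The replacement of `α` by `β` does not change the progress on level `m`. -/
def ActiveInvariant (m : ℕ) (α β : LevelVar →₀ ℕ) : Prop :=
  ∀ t v, Active m v (t + α) ↔ Active m v (t + β)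

/-- The replacement of `α` by `β` does not change modes and completed counters on level `m`. -/
def RunInvariant (m : ℕ) (α β : LevelVar →₀ ℕ) : Prop :=
  ∀ t j q, Run m j q (t + α) ↔ Run m j q (t + β)

theorem ActiveInvariant.runInvariant (h : ActiveInvariant m α β)
    (hα : ∀ i, α (C m i) = 0 ∧ α (B m i) = 0) (hβ : ∀ i, β (C m i) = 0 ∧ β (B m i) = 0) :
    RunInvariant m α β := by
  intro t j q
  simp only [Run, InMode, Finsupp.add_apply, (hα _).1, (hα _).2, (hβ _).1, (hβ _).2, h t]

/-- Variables on lower levels rule out the alternatives `AtS` and `AtF`, so the progress depends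
only on `Inner` and on the absence of S and F on level m + 1. -/
theorem activeInvariant_succ (h : ∀ t v, Inner m v (t + α) ↔ Inner m v (t + β))
    (hα : LivesBelow (m + 1) α) (hβ : LivesBelow (m + 1) β)
    (hα' : ¬ EmptyBelow (m + 1) α) (hβ' : ¬ EmptyBelow (m + 1) β) :
    ActiveInvariant (m + 1) α β := by
  intro t v
  obtain ⟨h1, h2, -⟩ := hα (m + 1) le_rfl
  obtain ⟨h3, h4, -⟩ := hβ (m + 1) le_rfl
  rw [active_succ_iff_inner (fun h => hα' (emptyBelow_add.1 h).2),
    active_succ_iff_inner (fun h => hβ' (emptyBelow_add.1 h).2), h t v]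
  simp only [Finsupp.add_apply, h1, h2, h3, h4]

theorem RunInvariant.activeInvariant_succ (h : RunInvariant m α β)
    (hα : LivesBelow (m + 1) α) (hβ : LivesBelow (m + 1) β)
    (hα' : ¬ EmptyBelow (m + 1) α) (hβ' : ¬ EmptyBelow (m + 1) β) :
    ActiveInvariant (m + 1) α β :=
  LevelVar.activeInvariant_succ (fun t v => by simp only [Inner, h t]) hα hβ hα' hβ'

theorem LivesBelow.apply_C_B (h : LivesBelow m w) (hmn : m ≤ n) (i : Fin 4) :
    w (C n i) = 0 ∧ w (B n i) = 0 :=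
  ⟨(h n hmn).2.2.1 i, (h n hmn).2.2.2 i⟩

theorem RunInvariant.activeInvariant (h : RunInvariant m α β)
    (hα : LivesBelow (m + 1) α) (hβ : LivesBelow (m + 1) β)
    (hα' : ¬ EmptyBelow (m + 1) α) (hβ' : ¬ EmptyBelow (m + 1) β) (hmn : m < n) :
    ActiveInvariant n α β := by
  induction n, hmn using Nat.le_induction with
  | base => exact h.activeInvariant_succ hα hβ hα' hβ'
  | succ n hmn ih =>
    have hmn' : m + 1 ≤ n + 1 := Nat.le_succ_of_le hmn
    exact (ih.runInvariant (hα.apply_C_B hmn) (hβ.apply_C_B hmn)).activeInvariant_succ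
      (hα.mono hmn') (hβ.mono hmn') (fun h => hα' (h.mono hmn')) (fun h => hβ' (h.mono hmn'))

theorem ActiveInvariant.mono (h : ActiveInvariant m α β)
    (hα : LivesBelow (m + 1) α) (hβ : LivesBelow (m + 1) β)
    (hαm : ∀ i, α (C m i) = 0 ∧ α (B m i) = 0) (hβm : ∀ i, β (C m i) = 0 ∧ β (B m i) = 0)
    (hα' : ¬ EmptyBelow (m + 1) α) (hβ' : ¬ EmptyBelow (m + 1) β) (hmn : m ≤ n) :
    ActiveInvariant n α β := by
  rcases hmn.eq_or_lt with rfl | hmn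
  · exact h
  · exact (h.runInvariant hαm hβm).activeInvariant hα hβ hα' hβ' hmn

/-- The top level `n` has no variables `C`, `B`, and the lower levels have made no progress. -/
def Start (n : ℕ) (w : LevelVar →₀ ℕ) : Prop :=
  (∀ l, w (C n l) = 0) ∧ (∀ l, w (B n l) = 0) ∧ Active n 0 w

/-- The replacement of `α` by `β` preserves `Run n` and `Start n`. -/
def Invariant (n : ℕ) (α β : LevelVar →₀ ℕ) : Prop :=
  RunInvariant n α β ∧ ∀ t, Start n (t + α) ↔ Start n (t + β)

theorem ActiveInvariant.invariant (h : ActiveInvariant n α β)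
    (hα : ∀ i, α (C n i) = 0 ∧ α (B n i) = 0) (hβ : ∀ i, β (C n i) = 0 ∧ β (B n i) = 0) :
    Invariant n α β := by
  refine ⟨h.runInvariant hα hβ, fun t => ?_⟩
  simp only [Start, Finsupp.add_apply, (hα _).1, (hα _).2, (hβ _).1, (hβ _).2, h t]

theorem not_emptyBelow_of_S (h : w (S m) ≠ 0) (hmn : m < n) : ¬ EmptyBelow n w :=
  fun h' => h (h' m hmn).1

theorem not_emptyBelow_of_F (h : w (F m) ≠ 0) (hmn : m < n) : ¬ EmptyBelow n w :=
  fun h' => h (h' m hmn).2.1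

theorem livesBelow_add (h1 : LivesBelow m α) (h2 : LivesBelow m β) : LivesBelow m (α + β) :=
  fun l hl => by
    obtain ⟨a1, a2, a3, a4⟩ := h1 l hl
    obtain ⟨b1, b2, b3, b4⟩ := h2 l hl
    simp [a1, a2, a3, a4, b1, b2, b3, b4]

theorem livesBelow_S (h : m < n) (c : ℕ) : LivesBelow n (single (S m) c) := by
  intro l hl; simp [(h.trans_le hl).ne]

theorem livesBelow_F (h : m < n) (c : ℕ) : LivesBelow n (single (F m) c) := by
  intro l hl; simp [(h.trans_le hl).ne]

theorem livesBelow_C (h : m < n) (i : Fin 4) (c : ℕ) : LivesBelow n (single (C m i) c) := by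
  intro l hl; simp [(h.trans_le hl).ne]

theorem livesBelow_B (h : m < n) (i : Fin 4) (c : ℕ) : LivesBelow n (single (B m i) c) := by
  intro l hl; simp [(h.trans_le hl).ne]

/-! ### Invariance under each type of Mayr–Meyer binomial. -/

/-- The monomial `S^(m) C_j^(m) (B_i^(m))^c`. -/
noncomputable def wordS (m : ℕ) (j i : Fin 4) (c : ℕ) : LevelVar →₀ ℕ :=
  single (S m) 1 + single (C m j) 1 + single (B m i) c

/-- The monomial `F^(m) C_j^(m) (B_i^(m))^c`. -/
noncomputable def wordF (m : ℕ) (j i : Fin 4) (c : ℕ) : LevelVar →₀ ℕ :=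
  single (F m) 1 + single (C m j) 1 + single (B m i) c

theorem livesBelow_wordS (h : m < n) (j i : Fin 4) (c : ℕ) : LivesBelow n (wordS m j i c) :=
  livesBelow_add (livesBelow_add (livesBelow_S h 1) (livesBelow_C h j 1)) (livesBelow_B h i c)

theorem livesBelow_wordF (h : m < n) (j i : Fin 4) (c : ℕ) : LivesBelow n (wordF m j i c) :=
  livesBelow_add (livesBelow_add (livesBelow_F h 1) (livesBelow_C h j 1)) (livesBelow_B h i c)

theorem not_emptyBelow_wordS (h : m < n) (j i : Fin 4) (c : ℕ) : ¬ EmptyBelow n (wordS m j i c) :=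
  not_emptyBelow_of_S (by simp [wordS]) h

theorem not_emptyBelow_wordF (h : m < n) (j i : Fin 4) (c : ℕ) : ¬ EmptyBelow n (wordF m j i c) :=
  not_emptyBelow_of_F (by simp [wordF]) h

theorem invariant_of_inner (h : ∀ t v, Inner m v (t + α) ↔ Inner m v (t + β))
    (hα : LivesBelow (m + 1) α) (hβ : LivesBelow (m + 1) β)
    (hα' : ¬ EmptyBelow (m + 1) α) (hβ' : ¬ EmptyBelow (m + 1) β) (hmn : m < n) :
    Invariant n α β := by
  have h1 := LevelVar.activeInvariant_succ h hα hβ hα' hβ'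
  have h2 : m + 1 ≤ m + 1 + 1 := Nat.le_succ _
  exact (h1.mono (hα.mono h2) (hβ.mono h2) (hα.apply_C_B le_rfl) (hβ.apply_C_B le_rfl)
    (fun h => hα' (h.mono h2)) (fun h => hβ' (h.mono h2)) hmn).invariant
    (hα.apply_C_B hmn) (hβ.apply_C_B hmn)

/-- The consumed B_0 is the 1 in q 0 + q 3 + 1 = e, and the new run in mode 1 starts with q 1 = e, q
2 = 0. Both sides have progress e * q 3. -/
theorem invariant_loop₁ (hmn : m < n) : Invariant n (wordF m 0 0 1) (wordS m 1 0 0) := by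
  have hm := Nat.lt_succ_self m
  refine invariant_of_inner (fun t v => ?_) (livesBelow_wordF hm _ _ _) (livesBelow_wordS hm _ _ _)
    (not_emptyBelow_wordF hm _ _ _) (not_emptyBelow_wordS hm _ _ _) hmn
  rw [wordF, wordS, inner_add_F, inner_add_S, Progress, Progress]
  refine and_congr_right fun _ => ?_
  simp
  omega

theorem invariant_loop₂ (hmn : m < n) : Invariant n (wordF m 1 0 0) (wordF m 2 0 0) := by
  have hm := Nat.lt_succ_self m
  refine invariant_of_inner (fun t v => ?_) (livesBelow_wordF hm _ _ _) (livesBelow_wordF hm _ _ _)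
    (not_emptyBelow_wordF hm _ _ _) (not_emptyBelow_wordF hm _ _ _) hmn
  rw [wordF, wordF, inner_add_F, inner_add_F, Progress, Progress]
  refine and_congr_right fun _ => ?_
  simp

/-- A finished round has q 2 = e; starting the next one trades this e for one more unit of q 3,
which has weight e. -/
theorem invariant_loop₃ (hmn : m < n) : Invariant n (wordS m 2 0 1) (wordS m 1 3 1) := by
  have hm := Nat.lt_succ_self m
  refine invariant_of_inner (fun t v => ?_) (livesBelow_wordS hm _ _ _) (livesBelow_wordS hm _ _ _)
    (not_emptyBelow_wordS hm _ _ _) (not_emptyBelow_wordS hm _ _ _) hmn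
  rw [wordS, wordS, inner_add_S, inner_add_S, Progress, Progress]
  refine and_congr_right fun _ => ?_
  simp [mul_add]
  omega

theorem invariant_loop₄ (hmn : m < n) : Invariant n (wordS m 2 0 0) (wordF m 3 3 1) := by
  have hm := Nat.lt_succ_self m
  refine invariant_of_inner (fun t v => ?_) (livesBelow_wordS hm _ _ _) (livesBelow_wordF hm _ _ _)
    (not_emptyBelow_wordS hm _ _ _) (not_emptyBelow_wordF hm _ _ _) hmn
  rw [wordS, wordF, inner_add_S, inner_add_F, Progress, Progress]
  refine and_congr_right fun _ => ?_
  simp [mul_add]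
  omega

/-- At S C_0 counter 0 already accounts for the full e, so q 0 + q 3 = e forces all B exponents to
vanish and the progress to be 0. For F^(m+1) and S C_3 the same argument gives q 3 = e and progress
e * e. -/
theorem activeInvariant_linkS : ActiveInvariant (m + 1) (single (S (m + 1)) 1) (wordS m 0 0 0) := by
  intro t v
  have hm := Nat.lt_succ_self m
  rw [active_iff_atS (by simp), active_succ_iff_inner
    (fun h => not_emptyBelow_wordS hm 0 0 0 (emptyBelow_add.1 h).2), wordS, inner_add_S, AtS,
    emptyBelow_add, emptyBelow_succ, Fresh, Progress]
  simp [emptyBelow_single_S, Fin.forall_fin_succ]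
  have := height_pos m
  intro _ _
  constructor
  · rintro ⟨rfl, h3, h4, h5, h6, h7, h8, h9, h10⟩
    simp_all
  · rintro ⟨⟨h3, h4, h5, h6⟩, h7, h8, h9, h10⟩
    have h11 : t (B m 3) = 0 := by omega
    have h12 : t (B m 0) = 0 := by omega
    simp_all

theorem activeInvariant_linkF : ActiveInvariant (m + 1) (single (F (m + 1)) 1) (wordS m 3 0 0) := by
  intro t v
  have hm := Nat.lt_succ_self m
  rw [active_iff_atF (by simp), active_succ_iff_inner
    (fun h => not_emptyBelow_wordS hm 3 0 0 (emptyBelow_add.1 h).2), wordS, inner_add_S, AtF,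
    emptyBelow_add, emptyBelow_succ, Fresh, Progress, height_succ]
  simp [emptyBelow_single_F, Fin.forall_fin_succ]
  have := height_pos m
  intro _ _
  constructor
  · rintro ⟨rfl, h3, h4, h5, h6, h7, h8, h9, h10⟩
    simp_all
  · rintro ⟨⟨h3, h4, h5, h6⟩, h7, h8, h9, h10⟩
    have h11 : t (B m 3) = 0 := by omega
    have h12 : t (B m 0) = 0 := by omega
    simp_all

theorem invariant_link (hmn : m < n) (x : LevelVar) (j : Fin 4)
    (hx : x = S (m + 1) ∨ x = F (m + 1))
    (h : ActiveInvariant (m + 1) (single x 1) (wordS m j 0 0)) :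
    Invariant n (single x 1) (wordS m j 0 0) := by
  have h1 : LivesBelow (m + 2) (single x 1) := by
    rcases hx with rfl | rfl
    · exact livesBelow_S (Nat.lt_succ_self _) 1
    · exact livesBelow_F (Nat.lt_succ_self _) 1
  have h2 : ¬ EmptyBelow (m + 2) (single x 1) := by
    rcases hx with rfl | rfl
    · exact not_emptyBelow_of_S (m := m + 1) (by simp) (Nat.lt_succ_self _)
    · exact not_emptyBelow_of_F (m := m + 1) (by simp) (Nat.lt_succ_self _)
  have h3 : ∀ l i, single x 1 (C l i) = 0 ∧ single x 1 (B l i) = 0 := by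
    rcases hx with rfl | rfl <;> simp
  have h4 : LivesBelow (m + 1) (wordS m j 0 0) := livesBelow_wordS (Nat.lt_succ_self m) _ _ _
  exact (h.mono h1 (h4.mono (Nat.le_succ _)) (h3 _) (h4.apply_C_B le_rfl) h2
    (not_emptyBelow_wordS (by omega) _ _ _) hmn).invariant (h3 _) (h4.apply_C_B hmn)

/-- Moving one unit from counter 1 to counter 2 keeps q 1 + q 2 and raises e * q 3 + q 2 by one;
modes 0 and 3 are excluded on both sides because these counters are not both 0. -/
theorem inner_shift : Inner m v (t + (single (F m) 1 + single (B m 1) 1)) ↔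
    Inner m (v + 1) (t + (single (F m) 1 + single (B m 2) 1)) := by
  rw [inner_iff_of_F (by simp), inner_iff_of_F (by simp)]
  simp only [AtF, emptyBelow_add, emptyBelow_single_F, emptyBelow_single_B, and_true, true_and,
    Finsupp.add_apply, single_apply, B.injEq, reduceCtorEq, if_true, if_false, add_zero,
    zero_add]
  refine and_congr_right fun _ => exists_congr fun j => and_congr_right fun _ => ?_
  simp [Progress]
  omega

theorem not_inner_zero : ¬ Inner m 0 (t + (single (F m) 1 + single (B m 2) 1)) := by
  rw [inner_iff_of_F (by simp)]
  rintro ⟨-, j, -, h⟩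
  simp [Progress] at h

/-- The monomial `C_i^(m+1) F^(m) B_2^(m)`. -/
noncomputable def wordL (m : ℕ) (i : Fin 4) : LevelVar →₀ ℕ :=
  single (C (m + 1) i) 1 + (single (F m) 1 + single (B m 1) 1)

/-- The monomial `C_i^(m+1) B_i^(m+1) F^(m) B_3^(m)`. -/
noncomputable def wordR (m : ℕ) (i : Fin 4) : LevelVar →₀ ℕ :=
  single (C (m + 1) i) 1 + single (B (m + 1) i) 1 + (single (F m) 1 + single (B m 2) 1)

theorem livesBelow_wordL (i : Fin 4) : LivesBelow (m + 2) (wordL m i) :=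
  livesBelow_add (livesBelow_C (by omega) _ _)
    (livesBelow_add (livesBelow_F (by omega) _) (livesBelow_B (by omega) _ _))

theorem livesBelow_wordR (i : Fin 4) : LivesBelow (m + 2) (wordR m i) :=
  livesBelow_add (livesBelow_add (livesBelow_C (by omega) _ _) (livesBelow_B (by omega) _ _))
    (livesBelow_add (livesBelow_F (by omega) _) (livesBelow_B (by omega) _ _))

/-- Locality: only variables of levels up to m are ever inspected. -/
theorem Inner.congr (h : ∀ l ≤ m, w (S l) = t (S l) ∧ w (F l) = t (F l) ∧
    (∀ i, w (C l i) = t (C l i)) ∧ ∀ i, w (B l i) = t (B l i)) :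
    Inner m v w ↔ Inner m v t := by
  have hE : ∀ l ≤ m + 1, EmptyBelow l w ↔ EmptyBelow l t := fun l hl => by
    simp only [EmptyBelow]
    refine forall₂_congr fun a ha => ?_
    obtain ⟨h1, h2, h3, h4⟩ := h a (by omega)
    simp only [h1, h2, h3, h4]
  have hA : ∀ l ≤ m, ∀ v, Active l v w ↔ Active l v t := by
    intro l
    induction l with
    | zero =>
      intro hl v
      obtain ⟨h1, h2, h3, h4⟩ := h 0 hl
      simp only [Active, AtS, AtF, h1, h2, hE 0 (by omega)]
    | succ l ih =>
      intro hl v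
      obtain ⟨h1, h2, h3, h4⟩ := h (l + 1) hl
      obtain ⟨h1', h2', h3', h4'⟩ := h l (by omega)
      simp only [Active, AtS, AtF, h1, h2, hE (l + 1) (by omega), InMode, ih (by omega), h3', h4']
  obtain ⟨h1, h2, h3, h4⟩ := h m le_rfl
  simp only [Inner, Run, InMode, hA m le_rfl, h3, h4]

theorem active_wordL (i : Fin 4) : Active (m + 1) v (t + wordL m i) ↔
    t (S (m + 1)) = 0 ∧ t (F (m + 1)) = 0 ∧
      Inner m v (t + (single (F m) 1 + single (B m 1) 1)) := by
  rw [active_succ_iff_inner (not_emptyBelow_of_F (m := m) (by simp [wordL]) (Nat.lt_succ_self m))]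
  refine and_congr (by simp [wordL]) (and_congr (by simp [wordL]) ?_)
  refine Inner.congr fun l hl => ?_
  have : m + 1 ≠ l := by omega
  simp [wordL, single_apply, this]

theorem active_wordR (i : Fin 4) : Active (m + 1) v (t + wordR m i) ↔
    t (S (m + 1)) = 0 ∧ t (F (m + 1)) = 0 ∧
      Inner m v (t + (single (F m) 1 + single (B m 2) 1)) := by
  rw [active_succ_iff_inner (not_emptyBelow_of_F (m := m) (by simp [wordR]) (Nat.lt_succ_self m))]
  refine and_congr (by simp [wordR]) (and_congr (by simp [wordR]) ?_)
  refine Inner.congr fun l hl => ?_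
  have : m + 1 ≠ l := by omega
  simp [wordR, single_apply, this]

/-- The progress v is not invariant here: it grows by one. The new factor B_i compensates, since i
is the mode and the completed counter contains `height (m + 1) - v`. Hence the invariance holds for
`Run`, not for `Active`, on level m + 1. -/
theorem runInvariant_transfer (i : Fin 4) : RunInvariant (m + 1) (wordL m i) (wordR m i) := by
  intro t j q
  simp only [Run, InMode, active_wordL, active_wordR]
  simp only [wordL, wordR, Finsupp.add_apply, single_apply, C.injEq, B.injEq, reduceCtorEq,
    if_false, add_zero, zero_add, true_and, show ¬ m = m + 1 by omega, false_and,
    add_ite_eq_ite_iff]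
  refine and_congr_right fun ⟨hj, _⟩ => ?_
  subst hj
  constructor
  · rintro ⟨v, hv, hq, h1, h2, h3⟩
    have h4 := inner_shift.1 h3
    refine ⟨v + 1, h4.le, fun l => ?_, h1, h2, h4⟩
    have := h4.le
    rw [hq l]
    by_cases hl : l = j
    · simp [hl]; omega
    · simp [hl, Ne.symm hl]
  · rintro ⟨v, hv, hq, h1, h2, h3⟩
    cases v with
    -- Truncated subtraction would break the count at v = 0, but the factor B_2^(m) makes q 2
    -- positive.
    | zero => exact absurd h3 not_inner_zero
    | succ v =>
      refine ⟨v, by omega, fun l => ?_, h1, h2, inner_shift.2 h3⟩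
      rw [hq l]
      by_cases hl : l = j
      · simp [hl]; omega
      · simp [hl, Ne.symm hl]

theorem invariant_transfer (hmn : m < n) (i : Fin 4) : Invariant n (wordL m i) (wordR m i) := by
  have h := runInvariant_transfer (m := m) i
  rcases (Nat.succ_le_of_lt hmn).eq_or_lt with rfl | hlt
  -- On the top level `Active` is not invariant, but both words contain C_i^(n), which `Start`
  -- forbids.
  · refine ⟨h, fun t => ⟨fun hs => ?_, fun hs => ?_⟩⟩
    · simpa [wordL] using hs.1 i
    · simpa [wordR] using hs.1 i
  · exact (h.activeInvariant (livesBelow_wordL i) (livesBelow_wordR i)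
      (not_emptyBelow_of_F (m := m) (by simp [wordL]) (by omega))
      (not_emptyBelow_of_F (m := m) (by simp [wordR]) (by omega)) hlt).invariant
      ((livesBelow_wordL i).apply_C_B hlt) ((livesBelow_wordR i).apply_C_B hlt)

/-- The two factors B_i on the right equal `height 0`, the amount still to be added at S^(0). -/
theorem runInvariant_base (i : Fin 4) : RunInvariant 0 (wordS 0 i 0 0) (wordF 0 i i 2) := by
  intro t j q
  simp only [Run, InMode]
  simp only [active_iff_atS (w := t + wordS 0 i 0 0) (m := 0) (by simp [wordS]),
    active_iff_atF (w := t + wordF 0 i i 2) (m := 0) (by simp [wordF]), AtS, AtF]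
  simp only [wordS, wordF, Finsupp.add_apply, single_apply, C.injEq, B.injEq,
    reduceCtorEq, if_false, add_zero, zero_add, true_and, if_true, ite_self, add_ite_eq_ite_iff]
  have h0 : ∀ w : LevelVar →₀ ℕ, EmptyBelow 0 w := fun w l hl => by omega
  refine and_congr_right fun ⟨hj, _⟩ => ?_
  subst hj
  constructor
  · rintro ⟨v, hv, hq, h1, h2, rfl, -⟩
    refine ⟨height 0, le_rfl, fun l => ?_, by omega, by omega, rfl, h0 _⟩
    rw [hq l, height_zero]
    by_cases hl : l = j
    · simp [hl]
    · simp [hl, Ne.symm hl]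
  · rintro ⟨v, hv, hq, h1, h2, rfl, -⟩
    refine ⟨0, Nat.zero_le _, fun l => ?_, by omega, by omega, rfl, h0 _⟩
    rw [hq l, height_zero]
    by_cases hl : l = j
    · simp [hl]
    · simp [hl, Ne.symm hl]

theorem invariant_base (hn : 0 < n) (i : Fin 4) :
    Invariant n (wordS 0 i 0 0) (wordF 0 i i 2) :=
  ((runInvariant_base i).activeInvariant (livesBelow_wordS one_pos _ _ _)
    (livesBelow_wordF one_pos _ _ _) (not_emptyBelow_wordS one_pos _ _ _)
    (not_emptyBelow_wordF one_pos _ _ _) hn).invariant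
    ((livesBelow_wordS one_pos _ _ _).apply_C_B hn) ((livesBelow_wordF one_pos _ _ _).apply_C_B hn)

end LevelVar

end Machine

end MayrMeyer

namespace MayrMeyer

open MvPolynomial

/-! ### Linear functionals that vanish on I. -/

section Functionals

variable {n : ℕ}

/-- The variables with their levels as natural numbers. -/
def toLevel : Var n → LevelVar
  | .S m => .S m
  | .F m => .F m
  | .C m i => .C m i
  | .B m i => .B m i

theorem toLevel_injective : Function.Injective (toLevel (n := n)) := by
  rintro (_ | _ | ⟨_, _⟩ | ⟨_, _⟩) (_ | _ | ⟨_, _⟩ | ⟨_, _⟩) h <;>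
    simp_all [toLevel, Fin.ext_iff]

theorem mapDomain_toLevel_apply (d : Var n →₀ ℕ) (x : Var n) :
    d.mapDomain toLevel (toLevel x) = d x :=
  Finsupp.mapDomain_apply toLevel_injective d x

variable (k : Type*) [Field k]

open LevelVar in
theorem generators_binomial (hn : 0 < n) {g : MvPolynomial (Var n) k}
    (hg : g ∈ generators k n) :
    ∃ α β : Var n →₀ ℕ, g = monomial α 1 - monomial β 1 ∧
      Invariant n (α.mapDomain toLevel) (β.mapDomain toLevel) := by
  rcases hg with (hg | hg) | ⟨i, rfl⟩
  · obtain ⟨m, hg⟩ := Set.mem_iUnion.1 hg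
    rcases hg with (rfl | rfl) | ⟨i, rfl⟩
    · refine ⟨Finsupp.single (Var.S m.succ) 1, Finsupp.single (Var.S m.castSucc) 1 +
        Finsupp.single (Var.C m.castSucc 0) 1, ?_, ?_⟩
      · simp [vS, vC, X, monomial_mul]
      · have h := invariant_link m.2 _ 0 (Or.inl rfl) activeInvariant_linkS
        simpa [Finsupp.mapDomain_add, Finsupp.mapDomain_single, toLevel, wordS] using h
    · refine ⟨Finsupp.single (Var.F m.succ) 1, Finsupp.single (Var.S m.castSucc) 1 +
        Finsupp.single (Var.C m.castSucc 3) 1, ?_, ?_⟩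
      · simp [vS, vF, vC, X, monomial_mul]
      · have h := invariant_link m.2 _ 3 (Or.inr rfl) activeInvariant_linkF
        simpa [Finsupp.mapDomain_add, Finsupp.mapDomain_single, toLevel, wordS] using h
    · refine ⟨Finsupp.single (Var.C m.succ i) 1 + (Finsupp.single (Var.F m.castSucc) 1 +
        Finsupp.single (Var.B m.castSucc 1) 1), Finsupp.single (Var.C m.succ i) 1 +
        Finsupp.single (Var.B m.succ i) 1 + (Finsupp.single (Var.F m.castSucc) 1 +
        Finsupp.single (Var.B m.castSucc 2) 1), ?_, ?_⟩
      · simp [vF, vC, vB, X, monomial_mul, add_assoc]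
      · have h := invariant_transfer m.2 i
        simpa [Finsupp.mapDomain_add, Finsupp.mapDomain_single, toLevel, wordL, wordR] using h
  · obtain ⟨m, hg⟩ := Set.mem_iUnion.1 hg
    rcases hg with rfl | rfl | rfl | rfl
    · refine ⟨Finsupp.single (Var.F m.castSucc) 1 + Finsupp.single (Var.C m.castSucc 0) 1 +
        Finsupp.single (Var.B m.castSucc 0) 1, Finsupp.single (Var.S m.castSucc) 1 +
        Finsupp.single (Var.C m.castSucc 1) 1, ?_, ?_⟩
      · simp [vS, vF, vC, vB, X, monomial_mul]
      · have h := invariant_loop₁ m.2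
        simpa [Finsupp.mapDomain_add, Finsupp.mapDomain_single, toLevel, wordS, wordF] using h
    · refine ⟨Finsupp.single (Var.F m.castSucc) 1 + Finsupp.single (Var.C m.castSucc 1) 1,
        Finsupp.single (Var.F m.castSucc) 1 + Finsupp.single (Var.C m.castSucc 2) 1, ?_, ?_⟩
      · simp [vF, vC, X, monomial_mul]
      · have h := invariant_loop₂ m.2
        simpa [Finsupp.mapDomain_add, Finsupp.mapDomain_single, toLevel, wordS, wordF] using h
    · refine ⟨Finsupp.single (Var.S m.castSucc) 1 + Finsupp.single (Var.C m.castSucc 2) 1 +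
        Finsupp.single (Var.B m.castSucc 0) 1, Finsupp.single (Var.S m.castSucc) 1 +
        Finsupp.single (Var.C m.castSucc 1) 1 + Finsupp.single (Var.B m.castSucc 3) 1, ?_, ?_⟩
      · simp [vS, vC, vB, X, monomial_mul]
      · have h := invariant_loop₃ m.2
        simpa [Finsupp.mapDomain_add, Finsupp.mapDomain_single, toLevel, wordS, wordF] using h
    · refine ⟨Finsupp.single (Var.S m.castSucc) 1 + Finsupp.single (Var.C m.castSucc 2) 1,
        Finsupp.single (Var.F m.castSucc) 1 + Finsupp.single (Var.C m.castSucc 3) 1 +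
        Finsupp.single (Var.B m.castSucc 3) 1, ?_, ?_⟩
      · simp [vS, vF, vC, vB, X, monomial_mul]
      · have h := invariant_loop₄ m.2
        simpa [Finsupp.mapDomain_add, Finsupp.mapDomain_single, toLevel, wordS, wordF] using h
  · refine ⟨Finsupp.single (Var.S 0) 1 + Finsupp.single (Var.C 0 i) 1,
      Finsupp.single (Var.F 0) 1 + Finsupp.single (Var.C 0 i) 1 +
        Finsupp.single (Var.B 0 i) 2, ?_, ?_⟩
    · simp only [vS, vF, vC, vB, X, monomial_mul, monomial_pow]
      simp [add_comm]
    · have h := invariant_base hn i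
      simpa [Finsupp.mapDomain_add, Finsupp.mapDomain_single, toLevel, wordS, wordF] using h

open Classical in
/-- The sum of the coefficients of the monomials that satisfy `P`. -/
noncomputable def coeffSum (P : (LevelVar →₀ ℕ) → Prop) : MvPolynomial (Var n) k →ₗ[k] k :=
  (basisMonomials (Var n) k).constr k fun d => if P (d.mapDomain toLevel) then 1 else 0

open Classical in
theorem coeffSum_monomial (P : (LevelVar →₀ ℕ) → Prop) (d : Var n →₀ ℕ) (c : k) :
    coeffSum k P (monomial d c) = if P (d.mapDomain toLevel) then c else 0 := by
  have h : (monomial d c : MvPolynomial (Var n) k) = c • basisMonomials (Var n) k d := by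
    simp [smul_monomial]
  rw [h, map_smul, coeffSum, Module.Basis.constr_basis]
  simp

variable {k}

theorem coeffSum_mul_binomial {P : (LevelVar →₀ ℕ) → Prop} {α β : Var n →₀ ℕ}
    (h : ∀ t, P (t + α.mapDomain toLevel) ↔ P (t + β.mapDomain toLevel))
    (p : MvPolynomial (Var n) k) :
    coeffSum k P (p * (monomial α 1 - monomial β 1)) = 0 := by
  induction p using MvPolynomial.induction_on' with
  | monomial d c =>
    rw [mul_sub, map_sub, monomial_mul, monomial_mul, coeffSum_monomial, coeffSum_monomial,
      Finsupp.mapDomain_add, Finsupp.mapDomain_add]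
    by_cases hc : P (Finsupp.mapDomain toLevel d + Finsupp.mapDomain toLevel α)
    · rw [if_pos hc, if_pos ((h _).1 hc), sub_self]
    · rw [if_neg hc, if_neg (fun hb => hc ((h _).2 hb)), sub_self]
  | add p q hp hq => rw [add_mul, map_add, hp, hq, add_zero]

theorem coeffSum_dehomogenize_of_mem_idealI (hn : 0 < n) {P : (LevelVar →₀ ℕ) → Prop}
    (hP : ∀ α β, LevelVar.Invariant n α β → ∀ t, P (t + α) ↔ P (t + β))
    {p : MvPolynomial (Option (Var n)) k} (hp : p ∈ idealI k n) :
    coeffSum k P (dehomogenize p) = 0 := by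
  -- The functional is only k-linear, so an arbitrary multiplier is carried through the induction.
  have key : ∀ q : MvPolynomial (Var n) k, coeffSum k P (q * dehomogenize p) = 0 := by
    induction hp using Submodule.span_induction with
    | mem x hx =>
      obtain ⟨g, hg, rfl⟩ := hx
      obtain ⟨α, β, rfl, h⟩ := generators_binomial k hn hg
      intro q
      rw [dehomogenize_homogenize]
      exact coeffSum_mul_binomial (hP _ _ h) q
    | zero => simp
    | add x y _ _ hx hy => intro q; rw [map_add, mul_add, map_add, hx, hy, add_zero]
    | smul r x _ hx => intro q; rw [smul_eq_mul, map_mul dehomogenize, ← mul_assoc]; exact hx _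
  simpa using key 1

theorem coeffSum_mul_X_eq_coeff {P : (LevelVar →₀ ℕ) → Prop} {x : Var n} {d₀ : Var n →₀ ℕ}
    (h : ∀ d : Var n →₀ ℕ,
      P (d.mapDomain toLevel + Finsupp.single (toLevel x) 1) ↔ d = d₀)
    (p : MvPolynomial (Var n) k) : coeffSum k P (p * X x) = coeff d₀ p := by
  classical
  induction p using MvPolynomial.induction_on' with
  | monomial d c =>
    rw [X, monomial_mul, coeffSum_monomial, Finsupp.mapDomain_add, Finsupp.mapDomain_single,
      coeff_monomial, mul_one]
    simp only [h]
  | add p q hp hq => rw [add_mul, map_add, hp, hq, coeff_add]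

theorem coeffSum_mul_X_eq_zero {P : (LevelVar →₀ ℕ) → Prop} {x : Var n}
    {p : MvPolynomial (Var n) k} (h : ∀ d : Var n →₀ ℕ, d.degree ≤ p.totalDegree →
      ¬ P (d.mapDomain toLevel + Finsupp.single (toLevel x) 1)) :
    coeffSum k P (p * X x) = 0 := by
  classical
  rw [p.as_sum, Finset.sum_mul, map_sum]
  refine Finset.sum_eq_zero fun d hd => ?_
  rw [X, monomial_mul, coeffSum_monomial, Finsupp.mapDomain_add, Finsupp.mapDomain_single]
  exact if_neg (h d (le_totalDegree hd))

open LevelVar in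
theorem start_add_S_iff (d : Var n →₀ ℕ) :
    Start n (d.mapDomain toLevel + Finsupp.single (toLevel (Var.S (Fin.last n))) 1) ↔ d = 0 := by
  have hx : toLevel (Var.S (Fin.last n)) = LevelVar.S n := rfl
  rw [hx, Start, active_iff_atS (by simp), AtS, emptyBelow_add]
  simp only [Finsupp.add_apply, Finsupp.single_apply, reduceCtorEq, if_false, add_zero, if_true,
    emptyBelow_single_S, and_true, true_and]
  constructor
  · rintro ⟨hC, hB, hS, hF, hE⟩
    ext x
    rw [← mapDomain_toLevel_apply, Finsupp.zero_apply]
    have hlt : ∀ m : Fin (n + 1), (m : ℕ) < n ∨ (m : ℕ) = n := fun m => by omega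
    cases x with
    | S m =>
      rcases hlt m with h | h
      · exact (hE m h).1
      · simp only [toLevel, h]; omega
    | F m =>
      rcases hlt m with h | h
      · exact (hE m h).2.1
      · simp only [toLevel, h, hF]
    | C m i =>
      rcases hlt m with h | h
      · exact (hE m h).2.2.1 i
      · simp only [toLevel, h, hC]
    | B m i =>
      rcases hlt m with h | h
      · exact (hE m h).2.2.2 i
      · simp only [toLevel, h, hB]
  · rintro rfl
    simp [EmptyBelow]

-- `Start` asks for progress 0, while F^(n) forces progress `height n`.
open LevelVar in
theorem not_start_add_F (t : LevelVar →₀ ℕ) :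
    ¬ Start n (t + Finsupp.single (toLevel (Var.F (Fin.last n))) 1) := by
  have hx : toLevel (Var.F (Fin.last n)) = LevelVar.F n := rfl
  rw [hx, Start, active_iff_atF (by simp), AtF]
  rintro ⟨-, -, -, -, h, -⟩
  exact (height_pos n).ne h

/-- The completed counters of the top level. -/
def topCounters (n : ℕ) : Fin 4 → ℕ := fun l => if l = 0 then LevelVar.height n else 0

-- At S^(n) nothing has been counted yet, so counter 0 completes to `height n` without any factor B,
-- and mode 0 leaves exactly the factor C_0.
open LevelVar in
theorem run_add_S_iff (d : Var n →₀ ℕ) :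
    Run n 0 (topCounters n)
      (d.mapDomain toLevel + Finsupp.single (toLevel (Var.S (Fin.last n))) 1) ↔
      d = Finsupp.single (Var.C (Fin.last n) 0) 1 := by
  classical
  have hx : toLevel (Var.S (Fin.last n)) = LevelVar.S n := rfl
  rw [hx, Run, InMode]
  simp only [active_iff_atS (m := n) (w := d.mapDomain toLevel + Finsupp.single (LevelVar.S n) 1)
    (by simp), AtS, emptyBelow_add, topCounters]
  simp only [Finsupp.add_apply, Finsupp.single_apply, reduceCtorEq, if_false, add_zero, if_true,
    emptyBelow_single_S, and_true]
  constructor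
  · rintro ⟨hC, v, -, hB, hS, hF, rfl, hE⟩
    have hB' : ∀ l, d.mapDomain toLevel (LevelVar.B n l) = 0 := fun l => by
      have := hB l
      rw [Nat.sub_zero] at this
      omega
    ext x
    rw [← mapDomain_toLevel_apply]
    have hlt : ∀ m : Fin (n + 1), ((m : ℕ) < n ∧ Fin.last n ≠ m) ∨ m = Fin.last n := fun m => by
      by_cases h : m = Fin.last n
      · exact Or.inr h
      · exact Or.inl ⟨Fin.val_lt_last h, Ne.symm h⟩
    cases x with
    | S m =>
      rcases hlt m with h | rfl
      · simpa [toLevel, Finsupp.single_apply] using (hE m h.1).1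
      · simpa [toLevel, Finsupp.single_apply] using hS
    | F m =>
      rcases hlt m with h | rfl
      · simpa [toLevel, Finsupp.single_apply] using (hE m h.1).2.1
      · simpa [toLevel, Finsupp.single_apply] using hF
    | C m i =>
      rcases hlt m with h | rfl
      · simpa [toLevel, Finsupp.single_apply, h.2] using (hE m h.1).2.2.1 i
      · simpa [toLevel, Finsupp.single_apply, eq_comm] using hC i
    | B m i =>
      rcases hlt m with h | rfl
      · simpa [toLevel, Finsupp.single_apply] using (hE m h.1).2.2.2 i
      · simpa [toLevel, Finsupp.single_apply] using hB' i
  · rintro rfl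
    simp only [Finsupp.mapDomain_single, toLevel, Fin.val_last, Finsupp.single_apply]
    refine ⟨fun l => by simp [eq_comm], 0, Nat.zero_le _, fun l => by simp, by simp, by simp, rfl,
      emptyBelow_single_C 0 1⟩

-- At F^(n) the count is finished, so the cofactor must be divisible by C_0 B_0^(`height n`), of
-- degree `height n` + 1. This is the source of the double exponential bound.
open LevelVar in
theorem not_run_add_F (d : Var n →₀ ℕ) (hd : d.degree ≤ height n) :
    ¬ Run n 0 (topCounters n)
      (d.mapDomain toLevel + Finsupp.single (toLevel (Var.F (Fin.last n))) 1) := by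
  classical
  have hx : toLevel (Var.F (Fin.last n)) = LevelVar.F n := rfl
  rw [hx, Run, InMode]
  simp only [active_iff_atF (m := n) (w := d.mapDomain toLevel + Finsupp.single (LevelVar.F n) 1)
    (by simp), AtF]
  rintro ⟨hC, v, -, hB, -, -, rfl, -⟩
  have h1 : d (Var.C (Fin.last n) 0) = 1 := by
    rw [← mapDomain_toLevel_apply]; simpa [toLevel, Finsupp.single_apply] using hC 0
  have h2 : d (Var.B (Fin.last n) 0) = height n := by
    rw [← mapDomain_toLevel_apply]
    simpa [toLevel, topCounters, Finsupp.single_apply, eq_comm] using hB 0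
  have hle : Finsupp.single (Var.C (Fin.last n) 0) 1 +
      Finsupp.single (Var.B (Fin.last n) 0) (height n) ≤ d := by
    intro x
    rw [Finsupp.add_apply, Finsupp.single_apply, Finsupp.single_apply]
    by_cases hc : Var.C (Fin.last n) 0 = x
    · subst hc; simp [h1]
    · by_cases hb : Var.B (Fin.last n) 0 = x
      · subst hb; simp [h2]
      · simp [hc, hb]
  obtain ⟨r, rfl⟩ := le_iff_exists_add.1 hle
  simp only [map_add, Finsupp.degree_single] at hd
  omega

/-- `Start` reads off the constant term of a, and `Run` in mode 0 its C_0 term; neither sees the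
multiple of F. Both coefficients are needed, since the vanishing of the C_0 coefficient alone does
not define an ideal. -/
theorem coeff_eq_zero_of_mem_idealI (hn : 0 < n) {a b : MvPolynomial (Option (Var n)) k}
    (h : a * X (some (Var.S (Fin.last n))) + b * X (some (Var.F (Fin.last n))) ∈ idealI k n)
    (hb : b.totalDegree ≤ LevelVar.height n) :
    coeff 0 (dehomogenize a) = 0 ∧
      coeff (Finsupp.single (Var.C (Fin.last n) 0) 1) (dehomogenize a) = 0 := by
  have hb' := (totalDegree_dehomogenize_le b).trans hb
  constructor
  · have h0 := coeffSum_dehomogenize_of_mem_idealI hn (P := LevelVar.Start n)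
      (fun α β hi => hi.2) h
    rw [map_add, map_mul, map_mul, dehomogenize_X_some, dehomogenize_X_some, map_add,
      coeffSum_mul_X_eq_coeff start_add_S_iff,
      coeffSum_mul_X_eq_zero fun d _ => not_start_add_F _, add_zero] at h0
    exact h0
  · have h0 := coeffSum_dehomogenize_of_mem_idealI hn (P := LevelVar.Run n 0 (topCounters n))
      (fun α β hi t => hi.1 t _ _) h
    rw [map_add, map_mul, map_mul, dehomogenize_X_some, dehomogenize_X_some, map_add,
      coeffSum_mul_X_eq_coeff run_add_S_iff,
      coeffSum_mul_X_eq_zero fun d hd => not_run_add_F d (hd.trans hb'), add_zero] at h0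
    exact h0

end Functionals

end MayrMeyer

namespace MayrMeyer

open MvPolynomial

/-! ### The derivation of the relation with a doubly exponential exponent. -/

section Ladder

/-- The Mayr–Meyer relations imply the relation with the exponent `2 ^ 2 ^ m`. -/
theorem ladder_relation {Q : Type*} [CommRing Q] (S F : ℕ → Q) (C B : ℕ → Fin 4 → Q) (n : ℕ)
    (hS : ∀ m < n, S (m + 1) = S m * C m 0) (hF : ∀ m < n, F (m + 1) = S m * C m 3)
    (hT : ∀ m < n, ∀ i,
      C (m + 1) i * F m * B m 1 = C (m + 1) i * B (m + 1) i * F m * B m 2)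
    (h₁ : ∀ m < n, F m * C m 0 * B m 0 = S m * C m 1)
    (h₂ : ∀ m < n, F m * C m 1 = F m * C m 2)
    (h₃ : ∀ m < n, S m * C m 2 * B m 0 = S m * C m 1 * B m 3)
    (h₄ : ∀ m < n, S m * C m 2 = F m * C m 3 * B m 3)
    (h₀ : ∀ i, C 0 i * S 0 = C 0 i * F 0 * B 0 i ^ 2) :
    ∀ m ≤ n, ∀ i, C m i * S m = C m i * F m * B m i ^ LevelVar.height m := by
  intro m
  induction m with
  | zero => exact fun _ i => h₀ i
  | succ m ih =>
    intro hm i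
    have H := ih (by omega)
    have hS := hS m hm
    have hF := hF m hm
    have hT := hT m hm i
    have h₁ := h₁ m hm
    have h₂ := h₂ m hm
    have h₃ := h₃ m hm
    have h₄ := h₄ m hm
    rw [LevelVar.height_succ]
    obtain ⟨r, hr⟩ : ∃ r, LevelVar.height m = r + 1 :=
      ⟨LevelVar.height m - 1, by have := LevelVar.height_pos m; omega⟩
    generalize LevelVar.height m = e at *
    generalize C (m + 1) i = c at *
    generalize B (m + 1) i = y at *
    -- The factor `c` is a catalyst: each transfer turns one B_1 into one B_2 and emits one `y`.
    have transfer : ∀ a : ℕ, c * F m * B m 1 ^ a = c * F m * (y * B m 2) ^ a := by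
      intro a
      induction a with
      | zero => simp
      | succ a iha =>
        calc c * F m * B m 1 ^ (a + 1) = c * F m * B m 1 * B m 1 ^ a := by ring
          _ = y * B m 2 * (c * F m * B m 1 ^ a) := by rw [hT]; ring
          _ = _ := by rw [iha]; ring
    -- One round: run forward in mode 1, transfer all e units, and run backward in mode 2.
    have loop : c * (S m * C m 1) = c * (S m * C m 2) * y ^ e := by
      calc c * (S m * C m 1) = c * (C m 1 * S m) := by ring
        _ = C m 1 * (c * F m * B m 1 ^ e) := by rw [H 1]; ring
        _ = c * (F m * C m 1) * B m 2 ^ e * y ^ e := by rw [transfer]; ring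
        _ = c * (C m 2 * F m * B m 2 ^ e) * y ^ e := by rw [h₂]; ring
        _ = _ := by rw [← H 2]; ring
    have loops : ∀ a : ℕ,
        c * (S m * C m 1) * B m 0 ^ a = c * (S m * C m 1) * (B m 3 * y ^ e) ^ a := by
      intro a
      induction a with
      | zero => simp
      | succ a iha =>
        calc c * (S m * C m 1) * B m 0 ^ (a + 1)
            = c * (S m * C m 1) * B m 0 * B m 0 ^ a := by ring
          _ = c * (S m * C m 2 * B m 0) * y ^ e * B m 0 ^ a := by rw [loop]; ring
          _ = c * (S m * C m 1) * B m 0 ^ a * (B m 3 * y ^ e) := by rw [h₃]; ring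
          _ = _ := by rw [iha]; ring
    -- Mode 0 produces e units of B_0. One is spent on entering the loop and r = e - 1 on further
    -- rounds, so e rounds emit `y ^ (e * e)`. The e units of B_3 are then used up by running
    -- backward in mode 3.
    calc c * S (m + 1) = c * (C m 0 * S m) := by rw [hS]; ring
      _ = c * (F m * C m 0 * B m 0) * B m 0 ^ r := by rw [H 0, hr]; ring
      _ = c * (S m * C m 2) * y ^ e * (B m 3 * y ^ e) ^ r := by rw [h₁, loops, loop]
      _ = c * (C m 3 * F m * B m 3 ^ (r + 1)) * (y ^ e) ^ (r + 1) := by rw [h₄]; ring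
      _ = c * F (m + 1) * y ^ (e * e) := by
        rw [← hr, ← H 3, hF, pow_mul]; ring

theorem ladder_mem_span (k : Type*) [Field k] (n : ℕ) :
    vC k (Fin.last n) 0 * vS k (Fin.last n) -
      vC k (Fin.last n) 0 * vF k (Fin.last n) * vB k (Fin.last n) 0 ^ LevelVar.height n ∈
      Ideal.span (generators k n) := by
  rw [← Ideal.Quotient.eq]
  have hq : ∀ p q : MvPolynomial (Var n) k, p - q ∈ generators k n →
      Ideal.Quotient.mk (Ideal.span (generators k n)) p = Ideal.Quotient.mk _ q :=
    fun p q h => Ideal.Quotient.eq.2 (Ideal.subset_span h)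
  have hlink : ∀ m : Fin n, ∀ g ∈ linkGenerators k m.castSucc m.succ, g ∈ generators k n :=
    fun m g hg => Or.inl (Or.inl (Set.mem_iUnion.2 ⟨m, hg⟩))
  have hloop : ∀ m : Fin n, ∀ g ∈ loopGenerators k m.castSucc, g ∈ generators k n :=
    fun m g hg => Or.inl (Or.inr (Set.mem_iUnion.2 ⟨m, hg⟩))
  let π := Ideal.Quotient.mk (Ideal.span (generators k n))
  let ℓ : ℕ → Fin (n + 1) := Fin.ofNat (n + 1)
  have hc : ∀ m (hm : m < n), ℓ m = (⟨m, hm⟩ : Fin n).castSucc := fun m hm =>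
    Fin.ext (Nat.mod_eq_of_lt (by omega))
  have hs : ∀ m (hm : m < n), ℓ (m + 1) = (⟨m, hm⟩ : Fin n).succ := fun m hm =>
    Fin.ext (Nat.mod_eq_of_lt (by omega))
  have hl : ℓ n = Fin.last n := Fin.ext (Nat.mod_eq_of_lt (by omega))
  have h := ladder_relation (fun m => π (vS k (ℓ m))) (fun m => π (vF k (ℓ m)))
    (fun m i => π (vC k (ℓ m) i)) (fun m i => π (vB k (ℓ m) i)) n
    (fun m hm => by
      simp only [hc m hm, hs m hm, ← map_mul]
      exact hq _ _ (hlink ⟨m, hm⟩ _ (Or.inl (Or.inl rfl))))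
    (fun m hm => by
      simp only [hc m hm, hs m hm, ← map_mul]
      exact hq _ _ (hlink ⟨m, hm⟩ _ (Or.inl (Or.inr rfl))))
    (fun m hm i => by
      simp only [hc m hm, hs m hm, ← map_mul]
      exact hq _ _ (hlink ⟨m, hm⟩ _ (Or.inr ⟨i, rfl⟩)))
    (fun m hm => by
      simp only [hc m hm, ← map_mul]
      exact hq _ _ (hloop ⟨m, hm⟩ _ (Or.inl rfl)))
    (fun m hm => by
      simp only [hc m hm, ← map_mul]
      exact hq _ _ (hloop ⟨m, hm⟩ _ (Or.inr (Or.inl rfl))))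
    (fun m hm => by
      simp only [hc m hm, ← map_mul]
      exact hq _ _ (hloop ⟨m, hm⟩ _ (Or.inr (Or.inr (Or.inl rfl)))))
    (fun m hm => by
      simp only [hc m hm, ← map_mul]
      exact hq _ _ (hloop ⟨m, hm⟩ _ (Or.inr (Or.inr (Or.inr rfl)))))
    (fun i => by
      simp only [← map_mul, ← map_pow]
      exact hq _ _ (Or.inr ⟨i, rfl⟩))
    n le_rfl 0
  simp only [hl, ← map_mul, ← map_pow] at h
  exact h

/-- The powers of u are irrelevant, because p is only tested at u = 1. -/
theorem exists_relation (k : Type*) [Field k] (n : ℕ) :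
    ∃ a b : MvPolynomial (Option (Var n)) k,
      a * X (some (Var.S (Fin.last n))) + b * X (some (Var.F (Fin.last n))) ∈ idealI k n ∧
      dehomogenize a = X (Var.C (Fin.last n) 0) := by
  obtain ⟨D, hD⟩ := homogenizeTo_mem_span (ladder_mem_span k n)
  have h := hD D le_rfl
  have h1 : (vC k (Fin.last n) 0 * vS k (Fin.last n) : MvPolynomial (Var n) k) =
      monomial (Finsupp.single (Var.C (Fin.last n) 0) 1 +
        Finsupp.single (Var.S (Fin.last n)) 1) 1 := by
    simp only [vC, vS, X, monomial_mul, one_mul]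
  have h2 : (vC k (Fin.last n) 0 * vF k (Fin.last n) * vB k (Fin.last n) 0 ^ LevelVar.height n :
      MvPolynomial (Var n) k) =
      monomial (Finsupp.single (Var.C (Fin.last n) 0) 1 + Finsupp.single (Var.F (Fin.last n)) 1 +
        Finsupp.single (Var.B (Fin.last n) 0) (LevelVar.height n)) 1 := by
    simp only [vC, vF, vB, X, monomial_mul, monomial_pow]
    simp
  rw [map_sub, h1, h2, homogenizeTo_monomial, homogenizeTo_monomial, ← h1, ← h2] at h
  simp only [vS, vF, vC, vB, map_mul, map_pow, rename_X] at h
  generalize D - Finsupp.degree _ = s at h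
  generalize D - Finsupp.degree _ = t at h
  refine ⟨X (some (Var.C (Fin.last n) 0)) * X none ^ s,
    -(X (some (Var.C (Fin.last n) 0)) * X (some (Var.B (Fin.last n) 0)) ^ LevelVar.height n *
      X none ^ t), ?_, ?_⟩
  · rw [idealI]
    convert! h using 1
    ring
  · rw [map_mul, map_pow, dehomogenize_X_none, dehomogenize_X_some, one_pow, mul_one]

end Ladder

/-! ### A first syzygy of large degree. -/

section Syzygies

variable {k : Type*} [Field k]

theorem eq_zero_or_eq_single_of_le_single {σ : Type*} {x : σ} {u : σ →₀ ℕ}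
    (h : u ≤ Finsupp.single x 1) : u = 0 ∨ u = Finsupp.single x 1 := by
  classical
  have h0 : ∀ y, y ≠ x → u y = 0 := fun y hy => by
    have := h y
    rw [Finsupp.single_apply, if_neg (Ne.symm hy)] at this
    omega
  have h1 : u x ≤ 1 := by simpa using h x
  rcases Nat.le_one_iff_eq_zero_or_eq_one.1 h1 with hx | hx
  · left; ext y
    by_cases hy : y = x
    · rw [hy, hx]; rfl
    · rw [h0 y hy]; rfl
  · right; ext y
    by_cases hy : y = x
    · rw [hy, hx]; simp
    · rw [h0 y hy, Finsupp.single_apply, if_neg (Ne.symm hy)]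

/-- The ideal of all polynomials whose dehomogenization has neither a constant term nor a term
in `x`. -/
noncomputable def lowTermIdeal {σ : Type*} (x : σ) : Ideal (MvPolynomial (Option σ) k) where
  carrier := {a | coeff 0 (dehomogenize a) = 0 ∧ coeff (Finsupp.single x 1) (dehomogenize a) = 0}
  zero_mem' := by simp
  add_mem' := fun ha hb => by
    simp only [Set.mem_ofPred_eq, map_add, coeff_add] at *
    simp [ha, hb]
  smul_mem' := fun p a ha => by
    classical
    simp only [Set.mem_ofPred_eq, smul_eq_mul, map_mul] at *
    obtain ⟨h0, h1⟩ := ha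
    generalize dehomogenize a = f at *
    induction dehomogenize p using MvPolynomial.induction_on' with
    | monomial d c =>
      rw [coeff_monomial_mul', coeff_monomial_mul']
      refine ⟨?_, ?_⟩
      · simp [h0]
      · rcases eq_zero_or_eq_single_of_le_single (x := x) (u := Finsupp.single x 1 - d)
          tsub_le_self with h | h
        · simp [h, h0]
        · simp [h, h1]
    | add p q hp hq => simp [add_mul, hp, hq]

/-- Taking the degree D part of any decomposition makes the coefficients homogeneous of degree D -
1, or zero, and keeps the remainder in the homogeneous ideal I. -/
theorem exists_low_decomposition (n : ℕ) {f : MvPolynomial (Option (Var n)) k} {D : ℕ}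
    (hf : f ∈ idealJ k n) (hD : f.IsHomogeneous D) :
    ∃ a b : MvPolynomial (Option (Var n)) k,
      f - (a * X (some (Var.S (Fin.last n))) + b * X (some (Var.F (Fin.last n)))) ∈ idealI k n ∧
      (b = 0 ∨ b.totalDegree + 1 ≤ D) := by
  obtain ⟨y, hy, i, hi, rfl⟩ := Submodule.mem_sup.1 hf
  obtain ⟨a, b, rfl⟩ := Ideal.mem_span_pair.1 hy
  refine ⟨shiftedComponent 1 D a, shiftedComponent 1 D b, ?_, ?_⟩
  · rw [← homogeneousComponent_eq_self hD, map_add, map_add,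
      homogeneousComponent_mul_of_isHomogeneous (isHomogeneous_X _ _),
      homogeneousComponent_mul_of_isHomogeneous (isHomogeneous_X _ _), add_sub_cancel_left]
    refine homogeneousComponent_mem_span ?_ hi D
    rintro _ ⟨g, -, rfl⟩
    exact ⟨_, homogenize_isHomogeneous g⟩
  · rcases shiftedComponent_isHomogeneous 1 D b with h | ⟨c, hc, h⟩
    · exact Or.inl h
    · exact Or.inr (by have := h.totalDegree_le; omega)

theorem MinimalResolution.exists_low_lift {σ : Type*} {I : Ideal (MvPolynomial σ k)}
    (P : MinimalResolution I) {f : MvPolynomial σ k} {D : ℕ} (hf : f ∈ I)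
    (hD : f.IsHomogeneous D) :
    ∃ x, P.aug x = f ∧ ∀ β, x β = 0 ∨ (x β).totalDegree + P.deg 0 β ≤ D := by
  rw [← P.range_aug] at hf
  obtain ⟨x, rfl⟩ := hf
  refine ⟨vectorComponent (P.deg 0) D x, ?_, fun β => ?_⟩
  · have h := vectorComponent_map (ι := Unit) (δ := fun _ => 0) (D := P.deg 0)
      (LinearMap.pi fun _ => P.aug)
      (fun i _ => Or.inr ⟨P.deg 0 i, zero_add _, P.aug_homogeneous i⟩) D x
    have h' := congrFun h ()
    simp only [vectorComponent_apply, LinearMap.pi_apply, shiftedComponent, Nat.zero_le, if_true,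
      Nat.sub_zero] at h'
    rw [← h', homogeneousComponent_eq_self hD]
  · rcases vectorComponent_isHomogeneousVector (P.deg 0) D x β with h | ⟨c, hc, h⟩
    · exact Or.inl h
    · exact Or.inr (by have := h.totalDegree_le; omega)

theorem map_eq_sum_single {R ι M : Type*} [CommRing R] [AddCommGroup M] [Module R M] [Fintype ι]
    [DecidableEq ι] (f : (ι → R) →ₗ[R] M) (z : ι → R) :
    f z = ∑ i, z i • f (Pi.single i 1) := by
  conv_lhs => rw [pi_eq_sum_univ' z, map_sum]
  simp only [map_smul]

theorem four_le_height {n : ℕ} (hn : 0 < n) : 4 ≤ LevelVar.height n := by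
  have h1 : 2 ^ 1 ≤ 2 ^ n := Nat.pow_le_pow_right (by omega) hn
  have h2 : 2 ^ 2 ≤ 2 ^ 2 ^ n := Nat.pow_le_pow_right (by omega) h1
  exact h2

theorem exists_large_syzygy {n : ℕ} (hn : 0 < n) (P : MinimalResolution (idealJ k n)) :
    ∃ α : Fin (P.rank 1), LevelVar.height n + 2 ≤ P.deg 1 α := by
  classical
  by_contra! hlow
  let s : MvPolynomial (Option (Var n)) k := X (some (Var.S (Fin.last n)))
  let f : MvPolynomial (Option (Var n)) k := X (some (Var.F (Fin.last n)))
  let N : Ideal (MvPolynomial (Option (Var n)) k) := lowTermIdeal (Var.C (Fin.last n) 0)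
  have hN : ∀ a b : MvPolynomial (Option (Var n)) k, a * s + b * f ∈ idealI k n →
      b.totalDegree ≤ LevelVar.height n → a ∈ N := fun a b h hb =>
    coeff_eq_zero_of_mem_idealI hn h hb
  have hIJ : idealI k n ≤ idealJ k n := le_sup_right
  have haug : ∀ x, P.aug x ∈ idealJ k n := fun x =>
    P.range_aug.le ⟨x, rfl⟩
  choose a b hab hb using fun β : Fin (P.rank 0) =>
    exists_low_decomposition n (haug (Pi.single β 1)) (P.aug_homogeneous β)
  let Φ := Fintype.linearCombination (MvPolynomial (Option (Var n)) k) a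
  let Ψ := Fintype.linearCombination (MvPolynomial (Option (Var n)) k) b
  have hΦΨ : ∀ x, P.aug x - (Φ x * s + Ψ x * f) ∈ idealI k n := fun x => by
    have : P.aug x - (Φ x * s + Ψ x * f) =
        ∑ β, x β * (P.aug (Pi.single β 1) - (a β * s + b β * f)) := by
      rw [map_eq_sum_single P.aug x]
      simp only [Φ, Ψ, Fintype.linearCombination_apply, smul_eq_mul, Finset.sum_mul,
        ← Finset.sum_add_distrib, ← Finset.sum_sub_distrib]
      exact Finset.sum_congr rfl fun β _ => by ring
    rw [this]
    exact sum_mem fun β _ => Ideal.mul_mem_left _ _ (hab β)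
  have hΨ : ∀ x D, (∀ β, x β = 0 ∨ (x β).totalDegree + P.deg 0 β ≤ D + 1) →
      (Ψ x).totalDegree ≤ D := fun x D hx => by
    rw [Fintype.linearCombination_apply]
    refine totalDegree_finsetSum_le fun β _ => ?_
    rcases hx β with h | h
    · simp [h]
    · rcases hb β with h' | h'
      · simp [h']
      · exact (totalDegree_mul _ _).trans (by omega)
  have hlowΦ : ∀ x, P.aug x ∈ idealI k n →
      (∀ β, x β = 0 ∨ (x β).totalDegree + P.deg 0 β ≤ LevelVar.height n + 1) → Φ x ∈ N :=
    fun x hx hdeg => hN _ (Ψ x)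
      (by simpa using sub_mem hx (hΦΨ x)) (hΨ x _ hdeg)
  -- The assumption on degrees enters here: syzygies are combinations of basis syzygies of degree at
  -- most `height n` + 1, and N is an ideal.
  have hker : ∀ x, P.aug x = 0 → Φ x ∈ N := fun x hx => by
    have hx' : x ∈ LinearMap.range (P.d 0) := by rw [P.exact_zero]; exact hx
    obtain ⟨z, rfl⟩ := hx'
    rw [map_eq_sum_single (P.d 0) z, map_sum]
    refine sum_mem fun α _ => ?_
    rw [map_smul]
    refine Submodule.smul_mem _ _ (hlowΦ _ ?_ fun β => ?_)
    · have : P.d 0 (Pi.single α 1) ∈ LinearMap.ker P.aug := by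
        rw [← P.exact_zero]; exact ⟨_, rfl⟩
      rw [LinearMap.mem_ker.1 this]
      exact zero_mem _
    · rcases P.d_homogeneous 0 α β with h | ⟨c, hc, h⟩
      · exact Or.inl h
      · have := h.totalDegree_le
        have := hlow α
        change P.deg 0 β + c = P.deg 1 α at hc
        exact Or.inr (by omega)
  -- The generators of I have degree at most 4 ≤ `height n`, hence lifts to which the low-degree
  -- bound applies.
  have hI : ∀ i ∈ idealI k n, ∃ x, P.aug x = i ∧ Φ x ∈ N := fun i hi => by
    have hi' : i ∈ Ideal.span (homogenize '' generators k n) := hi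
    induction hi' using Submodule.span_induction with
    | mem g hg =>
      have hg' : g ∈ idealI k n := Ideal.subset_span hg
      obtain ⟨e, he, hge⟩ := homogeneousGenerators_isHomogeneous k n g (Or.inr hg)
      obtain ⟨x, rfl, hx⟩ := P.exists_low_lift (hIJ hg') hge
      refine ⟨x, rfl, hlowΦ x hg' fun β => (hx β).imp_right fun h => ?_⟩
      have := four_le_height hn
      omega
    | zero => exact ⟨0, map_zero _, by rw [map_zero]; exact zero_mem _⟩
    | add u v hu hv ihu ihv =>
      obtain ⟨x, rfl, hx⟩ := ihu hu
      obtain ⟨y, rfl, hy⟩ := ihv hv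
      exact ⟨x + y, map_add _ _ _, by rw [map_add]; exact add_mem hx hy⟩
    | smul r u hu ihu =>
      obtain ⟨x, rfl, hx⟩ := ihu hu
      exact ⟨r • x, map_smul _ _ _, by rw [map_smul]; exact Submodule.smul_mem _ _ hx⟩
  have hsJ : s ∈ idealJ k n := Ideal.mem_sup_left (Ideal.subset_span (Or.inl rfl))
  have hfJ : f ∈ idealJ k n := Ideal.mem_sup_left (Ideal.subset_span (Or.inr rfl))
  obtain ⟨xs, hxs, hxs'⟩ := P.exists_low_lift hsJ (isHomogeneous_X k _)
  obtain ⟨xf, hxf, hxf'⟩ := P.exists_low_lift hfJ (isHomogeneous_X k _)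
  -- Modulo I, S equals Φ(xs) S + Ψ(xs) F with Ψ(xs) of degree 0; likewise Φ(xf) ∈ N below. So Φ is
  -- the S-coefficient modulo N.
  have hsN : 1 - Φ xs ∈ N := by
    refine hN _ (-Ψ xs) ?_ ?_
    · have := hΦΨ xs
      rw [hxs] at this
      convert this using 1
      ring
    · rw [totalDegree_neg]
      exact (hΨ xs 0 hxs').trans (Nat.zero_le _)
  have hfN : -Φ xf ∈ N := by
    refine hN _ (1 - Ψ xf) ?_ ?_
    · have := hΦΨ xf
      rw [hxf] at this
      convert this using 1
      ring
    · refine (totalDegree_sub _ _).trans (max_le (by simp) ?_)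
      exact (hΨ xf 0 hxf').trans (Nat.zero_le _)
  obtain ⟨p, q, hpq, hp⟩ := exists_relation k n
  obtain ⟨x, hx, hxN⟩ := hI _ hpq
  -- This is the syzygy given by the ladder relation; modulo N its image under Φ is p.
  have hz := hker (p • xs + q • xf - x) (by
    rw [map_sub, map_add, map_smul, map_smul, hxs, hxf, hx]
    exact sub_self _)
  have hpN : p ∈ N := by
    have h : p = (p * (1 - Φ xs) + q * (-Φ xf)) + Φ x + Φ (p • xs + q • xf - x) := by
      rw [map_sub, map_add, map_smul, map_smul, smul_eq_mul, smul_eq_mul]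
      ring
    rw [h]
    exact add_mem (add_mem (add_mem (N.mul_mem_left _ hsN) (N.mul_mem_left _ hfN)) hxN) hz
  have h := hpN.2
  rw [hp, X, coeff_monomial, if_pos rfl] at h
  exact one_ne_zero h

end Syzygies

end MayrMeyer

theorem proposition7 (k : Type*) [Field k] (n : ℕ) (hn : 1 ≤ n) :
    MayrMeyer.generatingDegree (MayrMeyer.idealJ k n) = 4 ∧
    ((2 ^ 2 ^ n + 1 : ℕ) : ℕ∞) ≤ MayrMeyer.regularity (MayrMeyer.idealJ k n) ∧
    ∀ P : MayrMeyer.MinimalResolution (MayrMeyer.idealJ k n),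
      ∃ α : Fin (P.rank 1), 2 ^ 2 ^ n + 2 ≤ P.deg 1 α := by
  refine ⟨MayrMeyer.generatingDegree_idealJ k n hn, le_sInf fun m hm => ?_,
    fun P => MayrMeyer.exists_large_syzygy hn P⟩
  obtain ⟨P⟩ := MayrMeyer.nonempty_minimalResolution (MayrMeyer.idealJ k n) (by
    rw [MayrMeyer.idealJ_eq_span]
    exact fun f hf D => MayrMeyer.homogeneousComponent_mem_span
      (fun g hg => (MayrMeyer.homogeneousGenerators_isHomogeneous k n g hg).imp
        fun e he => he.2) hf D)
  obtain ⟨α, hα⟩ := MayrMeyer.exists_large_syzygy hn P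
  -- The degree of a first syzygy is at most m + 1, so the bound for m is one less than the bound
  -- for the syzygy.
  have h := hm P 1 α
  cases m using ENat.recTopCoe with
  | top => exact le_top
  | coe m =>
    change 2 ^ 2 ^ n + 2 ≤ P.deg 1 α at hα
    norm_cast at h ⊢
    omega
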